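/- Let $X$ be a homogeneous compact complex manifold of complex dimension $n\ge 3$ and let $F$ be an invariant Hermitian metric on $X$, identified with its fundamental form, a smooth real positive $(1,1)$-form. Homogeneous and invariant mean the following: there are a group $G$ acting transitively by biholomorphisms on a complex manifold $M$, and a surjective local biholomorphism $\pi\colon M\to X$, such that $\pi^*F$ is $G$-invariant. (With $M=X$ and $\pi=\mathrm{id}$: the group $G$ acts transitively on $X$ by biholomorphisms preserving $F$. With $M=G$ a Lie group with a left-invariant complex structure and $X=\Gamma\backslash G$ a compact quotient by a discrete subgroup: $F$ is induced by a left-invariant Hermitian metric on $G$.) For $1\le k\le n-1$, the metric $F$ is called $k$-th Gauduchon if $\partial\bar\partial F^k\wedge F^{n-k-1}=0$; it is called Gauduchon if $\partial\bar\partial F^{n-1}=0$, that is, if it is $(n-1)$-th Gauduchon. Then: (i) $F$ is Gauduchon. (ii) If $F$ is $k$-th Gauduchon for some $k$ with $1\le k\le n-2$, then $F$ is $k$-th Gauduchon for every $k$ with $1\le k\le n-2$. (iii) For every $k$ with $1\le k\le n-1$ there is a unique real constant $C_{F,k}$ such that $$\frac{i}{2}\,\partial\bar\partial F^k\wedge F^{n-k-1}=C_{F,k}\,F^n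 ,$$ and these constants satisfy $C_{F,n-1}=0$ and $$C_{F,k}=\frac{k(n-k-1)}{n-2}\,C_{F,1}\qquad\text{for } 1\le k\le n-2 .$$ -/

import Mathlib

open scoped Manifold ContDiff

noncomputable section

namespace Gauduchon

section Algebra

variable {E : Type*} [NormedAddCommGroup E] [NormedSpace ℂ E]

/-- The wedge product of complex-valued alternating real-multilinear forms, as a plain alternating
map. The sum runs over shuffles, so that `(dx ∧ dy)(u, v) = dx(u) dy(v) - dx(v) dy(u)`. -/
def wedgeAux {p q : ℕ} (a : E [⋀^Fin p]→L[ℝ] ℂ) (b : E [⋀^Fin q]→L[ℝ] ℂ) :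
    E [⋀^Fin (p + q)]→ₗ[ℝ] ℂ :=
  ((LinearMap.mul' ℝ ℂ).compAlternatingMap
    (a.toAlternatingMap.domCoprod b.toAlternatingMap)).domDomCongr finSumFinEquiv

theorem continuous_wedgeAux {p q : ℕ} (a : E [⋀^Fin p]→L[ℝ] ℂ) (b : E [⋀^Fin q]→L[ℝ] ℂ) :
    Continuous fun v : Fin (p + q) → E => wedgeAux a b v := by
  have key : ∀ σ : Equiv.Perm.ModSumCongr (Fin p) (Fin q),
      Continuous fun v : Fin p ⊕ Fin q → E => LinearMap.mul' ℝ ℂ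
        (AlternatingMap.domCoprod.summand a.toAlternatingMap b.toAlternatingMap σ v) := by
    intro σ
    induction σ using Quotient.inductionOn' with
    | _ σ =>
      have h : (fun v : Fin p ⊕ Fin q → E => LinearMap.mul' ℝ ℂ
          (AlternatingMap.domCoprod.summand a.toAlternatingMap b.toAlternatingMap
            (Quotient.mk'' σ) v)) = fun v => Equiv.Perm.sign σ •
              (a (fun i => v (σ (Sum.inl i))) * b (fun i => v (σ (Sum.inr i)))) := by
        funext v
        rw [AlternatingMap.domCoprod.summand_mk'']
        rcases Int.units_eq_one_or (Equiv.Perm.sign σ) with hs | hs <;> simp [hs]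
      rw [h]
      have h1 : Continuous fun v : Fin p ⊕ Fin q → E => a (fun i => v (σ (Sum.inl i))) :=
        a.cont.comp (by fun_prop)
      have h2 : Continuous fun v : Fin p ⊕ Fin q → E => b (fun i => v (σ (Sum.inr i))) :=
        b.cont.comp (by fun_prop)
      exact (h1.mul h2).const_smul _
  have hsum : Continuous fun v : Fin p ⊕ Fin q → E =>
      ∑ σ : Equiv.Perm.ModSumCongr (Fin p) (Fin q), LinearMap.mul' ℝ ℂ
        (AlternatingMap.domCoprod.summand a.toAlternatingMap b.toAlternatingMap σ v) :=
    continuous_finsetSum _ fun σ _ => key σ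
  have hcomp : Continuous fun (v : Fin (p + q) → E) (i : Fin p ⊕ Fin q) =>
      v (finSumFinEquiv i) := by fun_prop
  refine (hsum.comp hcomp).congr fun v => ?_
  simp only [Function.comp_apply, wedgeAux, AlternatingMap.domDomCongr_apply,
    LinearMap.compAlternatingMap_apply, AlternatingMap.domCoprod_apply, sum_apply,
    map_sum]
  rfl

/-- The wedge product `a ∧ b` of complex-valued alternating real-multilinear forms. -/
def wedge {p q : ℕ} (a : E [⋀^Fin p]→L[ℝ] ℂ) (b : E [⋀^Fin q]→L[ℝ] ℂ) :
    E [⋀^Fin (p + q)]→L[ℝ] ℂ :=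
  { wedgeAux a b with cont := continuous_wedgeAux a b }

/-- The power `a ^ k = a ∧ ⋯ ∧ a` (`k` factors) of a form of degree two; `a ^ 0 = 1`. -/
def wedgePow (a : E [⋀^Fin 2]→L[ℝ] ℂ) : (k : ℕ) → E [⋀^Fin (2 * k)]→L[ℝ] ℂ
  | 0 => ContinuousAlternatingMap.constOfIsEmpty ℝ E (Fin 0) (1 : ℂ)
  | k + 1 => wedge (wedgePow a k) a

end Algebra

section Flat

variable {E : Type*} [NormedAddCommGroup E] [NormedSpace ℂ E]

/-- Multiplication by `i` on a complex vector space, as a real-linear map. -/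
def mulI (E : Type*) [NormedAddCommGroup E] [NormedSpace ℂ E] : E →L[ℝ] E :=
  (Complex.I • ContinuousLinearMap.id ℂ E).restrictScalars ℝ

/-- `∂α` for a differential form on a complex vector space: the antisymmetrization of the
complex-linear part `v ↦ (Dα(v) - i Dα(iv)) / 2` of the derivative `Dα`. In linear coordinates `z`,
`∂(f dz_I ∧ dz̄_J) = ∑ k, (∂f/∂z_k) dz_k ∧ dz_I ∧ dz̄_J`. -/
def flatDel {p : ℕ} (α : E → E [⋀^Fin p]→L[ℝ] ℂ) (x : E) : E [⋀^Fin (p + 1)]→L[ℝ] ℂ :=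
  ContinuousAlternatingMap.alternatizeUncurryFin
    ((1 / 2 : ℂ) • (fderiv ℝ α x - Complex.I • (fderiv ℝ α x).comp (mulI E)))

/-- `∂̄α` for a differential form on a complex vector space: the antisymmetrization of the
complex-antilinear part `v ↦ (Dα(v) + i Dα(iv)) / 2` of the derivative `Dα`. In linear
coordinates `z`, `∂̄(f dz_I ∧ dz̄_J) = ∑ k, (∂f/∂z̄_k) dz̄_k ∧ dz_I ∧ dz̄_J`. -/
def flatDelbar {p : ℕ} (α : E → E [⋀^Fin p]→L[ℝ] ℂ) (x : E) : E [⋀^Fin (p + 1)]→L[ℝ] ℂ :=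
  ContinuousAlternatingMap.alternatizeUncurryFin
    ((1 / 2 : ℂ) • (fderiv ℝ α x + Complex.I • (fderiv ℝ α x).comp (mulI E)))

end Flat

section Manifold

/-- Complex-valued differential `p`-forms on a complex manifold `X` modelled on `E`: the value at
`x` is a form on the tangent space `TangentSpace 𝓘(ℂ, E) x`, which by definition is `E` (it is
identified with `E` through the preferred chart at `x`). -/
abbrev DForm (E : Type*) [NormedAddCommGroup E] [NormedSpace ℂ E] (X : Type*) (p : ℕ) :=
  X → E [⋀^Fin p]→L[ℝ] ℂ

variable {E : Type*} [NormedAddCommGroup E] [NormedSpace ℂ E]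
  {X : Type*} [TopologicalSpace X] [ChartedSpace E X]
  {M : Type*} [TopologicalSpace M] [ChartedSpace E M]

/-- The differential at `x` of a map between complex manifolds, as a real-linear map. -/
def realDifferential (f : M → X) (x : M) : E →L[ℝ] E :=
  let L : E →L[ℂ] E := mfderiv 𝓘(ℂ, E) 𝓘(ℂ, E) f x
  L.restrictScalars ℝ

/-- The pullback `f^* α`. -/
def pullback {p : ℕ} (f : M → X) (α : DForm E X p) : DForm E M p := fun x =>
  (α (f x)).compContinuousLinearMap (realDifferential f x)

/-- The expression of `α` in the preferred chart at `x₀` (meaningful on the target of that chart):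
the pullback of `α` by the inverse of the chart. -/
def inChart {p : ℕ} (α : DForm E X p) (x₀ : X) : E → E [⋀^Fin p]→L[ℝ] ℂ :=
  pullback (chartAt E x₀).symm α

/-- `∂α` on a complex manifold, computed at each point in the preferred holomorphic chart. -/
def del {p : ℕ} (α : DForm E X p) : DForm E X (p + 1) := fun x =>
  flatDel (inChart α x) (chartAt E x x)

/-- `∂̄α` on a complex manifold, computed at each point in the preferred holomorphic chart. -/
def delbar {p : ℕ} (α : DForm E X p) : DForm E X (p + 1) := fun x =>
  flatDelbar (inChart α x) (chartAt E x x)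

/-- A form is smooth if its expression in each preferred chart is. -/
def IsSmooth {p : ℕ} (α : DForm E X p) : Prop :=
  ∀ x₀ : X, ContDiffOn ℝ ∞ (inChart α x₀) (chartAt E x₀).target

/-- A Hermitian metric on a complex manifold, given by its fundamental form `F`, a smooth real
positive `(1,1)`-form. The associated Riemannian metric is `g(u, v) = F(u, iv)`. -/
structure HermitianMetric (E : Type*) [NormedAddCommGroup E] [NormedSpace ℂ E]
    (X : Type*) [TopologicalSpace X] [ChartedSpace E X] where
  /-- The fundamental form, as a complex-valued form. -/
  form : DForm E X 2
  real : ∀ x v, (form x v).im = 0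
  map_I_smul : ∀ (x : X) (u v : E), form x ![Complex.I • u, Complex.I • v] = form x ![u, v]
  pos : ∀ (x : X) (v : E), v ≠ 0 → 0 < (form x ![v, Complex.I • v]).re
  smooth : IsSmooth form

namespace HermitianMetric

/-- The form `F ^ k`. -/
def pow (F : HermitianMetric E X) (k : ℕ) : DForm E X (2 * k) := fun x => wedgePow (F.form x) k

/-- `F` is Gauduchon (`n` is the complex dimension): `∂∂̄(F ^ (n - 1)) = 0`. -/
def IsGauduchon (F : HermitianMetric E X) (n : ℕ) : Prop :=
  ∀ x, del (delbar (F.pow (n - 1))) x = 0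

/-- `∂∂̄(F ^ k) ∧ F ^ (n - k - 1)`. -/
def gauduchonForm (F : HermitianMetric E X) (n k : ℕ) :
    DForm E X (2 * k + 1 + 1 + 2 * (n - k - 1)) := fun x =>
  wedge (del (delbar (F.pow k)) x) (F.pow (n - k - 1) x)

/-- `F` is `k`-th Gauduchon (`n` is the complex dimension, `1 ≤ k ≤ n - 1`):
`∂∂̄(F ^ k) ∧ F ^ (n - k - 1) = 0`. -/
def IsKthGauduchon (F : HermitianMetric E X) (n k : ℕ) : Prop :=
  ∀ x, F.gauduchonForm n k x = 0

/-- The real number `c` satisfies `(i/2) ∂∂̄(F ^ k) ∧ F ^ (n - k - 1) = c F ^ n`. The cast identifies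
the two expressions of the degree `2n`. -/
def IsGauduchonConstant (F : HermitianMetric E X) (n k : ℕ) (hk : k + 1 ≤ n) (c : ℝ) : Prop :=
  ∀ (x : X) (v : Fin (2 * n) → E),
    Complex.I / 2 * F.gauduchonForm n k x
        (fun i => v (Fin.cast (show 2 * k + 1 + 1 + 2 * (n - k - 1) = 2 * n by omega) i)) =
      c * F.pow n x v

/-- `F` is an invariant Hermitian metric on the homogeneous manifold `X`: there are a group `G`
acting transitively by biholomorphisms on a complex manifold `M`, and a surjective local
biholomorphism `π : M → X`, such that `π^* F` is `G`-invariant.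

If `π` is the identity of `X`, then this says that `G` acts transitively on `X` by biholomorphisms
which preserve `F`. If `M = G` is a Lie group with a left-invariant complex structure, on which it
acts by left translations, and `π` is the projection onto the quotient `X = Γ \ G` by a discrete
subgroup, then this says that `F` is induced by a left-invariant Hermitian metric on `G`. -/
structure IsInvariant (F : HermitianMetric E X) (G : Type*) [Group G] [MulAction G M]
    (π : M → X) : Prop where
  transitive : MulAction.IsPretransitive G M
  holomorphic : ∀ g : G, ContMDiff 𝓘(ℂ, E) 𝓘(ℂ, E) ω fun m : M => g • m
  localBiholomorphism : IsLocalDiffeomorph 𝓘(ℂ, E) 𝓘(ℂ, E) ω π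
  surjective : Function.Surjective π
  invariant : ∀ g : G,
    pullback (fun m : M => g • m) (pullback π F.form) = pullback π F.form

end HermitianMetric

end Manifold

end Gauduchon

end

/-! Since `F ^ n` vanishes nowhere and top-degree forms at a point are a line, at each point `(i/2)
∂∂̄(F ^ k) ∧ F ^ (n - k - 1)` is a unique multiple `f k` of `F ^ n`. The pullback of either form
depends only on the pullback of `F`. As `π` and `π ∘ g` pull `F` back to the same form and `G` is
transitive, `f k` does not depend on the point (`IsInvariant.isFactorAt_congr`). It is real because
`i∂∂̄` is a real operator.

Two-forms are central, so `∂∂̄(F ^ k) = k ∂∂̄F ∧ F ^ (k - 1) + k (k - 1) ∂F ∧ F ^ (k - 2) ∧ ∂̄F`.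
Wedging with `F ^ (n - k - 1)` leaves two top forms that no longer involve `k`, namely `∂∂̄F ∧ F ^
(n - 2)` and `∂F ∧ ∂̄F ∧ F ^ (n - 3)`. Hence `f k = k a + k (k - 1) b` with `a`, `b` independent of
`k` (`exists_isFactorAt_quadratic`).

For `k = n - 1` the form is `∂`-exact up to a constant, so Stokes' theorem on the compact `X`
together with the positivity of `F ^ n` gives `f (n - 1) = 0` (`eq_zero_of_isFactorAt_sub_one`).
Therefore `a = -(n - 2) b` and `f k = k (n - k - 1) / (n - 2) * f 1`. The coefficient is nonzero for
`1 ≤ k ≤ n - 2`, so one `f k` in this range vanishes exactly when all do.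

Most of the file supplies the calculus: a ring of forms in which degrees need no casts, the
naturality of `∂` and `∂̄` under holomorphic maps, the positivity of `F ^ n`, and Stokes' theorem
through a partition of unity. -/

noncomputable section

namespace Gauduchon

/-! ### The graded ring of alternating forms. -/

section FormAlgebra

variable {E : Type*} [AddCommGroup E] [Module ℝ E]

/-- The wedge product of alternating forms, without continuity. -/
def altWedge {p q : ℕ} (a : E [⋀^Fin p]→ₗ[ℝ] ℂ) (b : E [⋀^Fin q]→ₗ[ℝ] ℂ) :
    E [⋀^Fin (p + q)]→ₗ[ℝ] ℂ :=
  ((LinearMap.mul' ℝ ℂ).compAlternatingMap (a.domCoprod b)).domDomCongr finSumFinEquiv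

/-- The tensor product of multilinear forms. -/
def tensorMul {p q : ℕ} (f : MultilinearMap ℝ (fun _ : Fin p => E) ℂ)
    (g : MultilinearMap ℝ (fun _ : Fin q => E) ℂ) :
    MultilinearMap ℝ (fun _ : Fin (p + q) => E) ℂ :=
  ((LinearMap.mul' ℝ ℂ).compMultilinearMap (f.domCoprod g)).domDomCongr finSumFinEquiv

theorem tensorMul_apply {p q : ℕ} (f : MultilinearMap ℝ (fun _ : Fin p => E) ℂ)
    (g : MultilinearMap ℝ (fun _ : Fin q => E) ℂ) (v : Fin (p + q) → E) :
    tensorMul f g v = f (fun i => v (Fin.castAdd q i)) * g (fun i => v (Fin.natAdd p i)) := by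
  simp [tensorMul]

theorem alternatization_apply' {p : ℕ} (f : MultilinearMap ℝ (fun _ : Fin p => E) ℂ)
    (v : Fin p → E) :
    MultilinearMap.alternatization f v =
      ∑ σ : Equiv.Perm (Fin p), (Equiv.Perm.sign σ : ℤ) • f (fun i => v (σ i)) := by
  simp [MultilinearMap.alternatization_apply, Units.smul_def]

/-- Alternatization is the plain signed sum over all permutations, without a factorial, so it
matches the shuffle normalization of the wedge product exactly. -/
theorem alternatization_tensorMul {p q : ℕ} (f : MultilinearMap ℝ (fun _ : Fin p => E) ℂ)
    (g : MultilinearMap ℝ (fun _ : Fin q => E) ℂ) :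
    MultilinearMap.alternatization (tensorMul f g) =
      altWedge (MultilinearMap.alternatization f) (MultilinearMap.alternatization g) := by
  ext v
  rw [altWedge, ← MultilinearMap.domCoprod_alternization, alternatization_apply']
  simp only [AlternatingMap.domDomCongr_apply, LinearMap.compAlternatingMap_apply,
    MultilinearMap.alternatization_apply, map_sum]
  rw [← Equiv.sum_comp (finSumFinEquiv (m := p) (n := q)).permCongr]
  refine Finset.sum_congr rfl fun σ _ => ?_
  rw [Equiv.Perm.sign_permCongr, tensorMul_apply]
  rcases Int.units_eq_one_or (Equiv.Perm.sign σ) with hs | hs <;>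
    simp [hs, Equiv.permCongr_apply]

/-- The multilinear form whose alternatization is `a`. -/
def unalt {p : ℕ} (a : E [⋀^Fin p]→ₗ[ℝ] ℂ) : MultilinearMap ℝ (fun _ : Fin p => E) ℂ :=
  ((p.factorial : ℝ)⁻¹ • a).toMultilinearMap

theorem unalt_apply {p : ℕ} (a : E [⋀^Fin p]→ₗ[ℝ] ℂ) (v : Fin p → E) :
    unalt a v = ((p.factorial : ℝ)⁻¹ : ℝ) • a v := rfl

theorem alternatization_unalt {p : ℕ} (a : E [⋀^Fin p]→ₗ[ℝ] ℂ) :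
    MultilinearMap.alternatization (unalt a) = a := by
  have h := AlternatingMap.coe_alternatization (((p.factorial : ℝ)⁻¹ : ℝ) • a)
  have h2 : (unalt a) = ↑(((p.factorial : ℝ)⁻¹ : ℝ) • a) := rfl
  rw [h2, h, Fintype.card_fin, ← Nat.cast_smul_eq_nsmul ℝ, smul_smul,
    mul_inv_cancel₀ (by exact_mod_cast p.factorial_ne_zero), one_smul]

/-- Reduces identities between wedge products to pointwise identities between tensor products, where
associativity and the unit laws are those of multiplication in `ℂ`. -/
theorem altWedge_eq {p q : ℕ} (a : E [⋀^Fin p]→ₗ[ℝ] ℂ) (b : E [⋀^Fin q]→ₗ[ℝ] ℂ) :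
    altWedge a b = MultilinearMap.alternatization (tensorMul (unalt a) (unalt b)) := by
  rw [alternatization_tensorMul, alternatization_unalt, alternatization_unalt]

/-- A normalized sum over all permutations for the wedge product. -/
theorem altWedge_apply {p q : ℕ} (a : E [⋀^Fin p]→ₗ[ℝ] ℂ) (b : E [⋀^Fin q]→ₗ[ℝ] ℂ)
    (v : Fin (p + q) → E) :
    altWedge a b v = ((p.factorial : ℝ)⁻¹ * (q.factorial : ℝ)⁻¹ : ℝ) •
      ∑ σ : Equiv.Perm (Fin (p + q)), (Equiv.Perm.sign σ : ℤ) •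
        (a (fun i => v (σ (Fin.castAdd q i))) * b (fun i => v (σ (Fin.natAdd p i)))) := by
  rw [altWedge_eq, alternatization_apply', Finset.smul_sum]
  refine Finset.sum_congr rfl fun σ _ => ?_
  rw [tensorMul_apply, unalt_apply, unalt_apply, smul_mul_smul_comm, smul_comm]

theorem gradedMonoid_eq {p q : ℕ} {a : E [⋀^Fin p]→ₗ[ℝ] ℂ} {b : E [⋀^Fin q]→ₗ[ℝ] ℂ} (h : p = q)
    (hab : ∀ v : Fin q → E, a (fun i => v (Fin.cast h i)) = b v) :
    (GradedMonoid.mk p a : GradedMonoid fun p => E [⋀^Fin p]→ₗ[ℝ] ℂ) = GradedMonoid.mk q b := by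
  subst h
  congr 1
  ext v
  exact hab v

theorem alternatization_cast {p q : ℕ} (h : p = q) (f : MultilinearMap ℝ (fun _ : Fin p => E) ℂ)
    (g : MultilinearMap ℝ (fun _ : Fin q => E) ℂ)
    (hfg : ∀ v : Fin q → E, f (fun i => v (Fin.cast h i)) = g v) (v : Fin q → E) :
    MultilinearMap.alternatization f (fun i => v (Fin.cast h i)) =
      MultilinearMap.alternatization g v := by
  subst h
  have : f = g := by ext v; exact hfg v
  rw [this]
  rfl

theorem altWedge_assoc {p q r : ℕ} (a : E [⋀^Fin p]→ₗ[ℝ] ℂ) (b : E [⋀^Fin q]→ₗ[ℝ] ℂ)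
    (c : E [⋀^Fin r]→ₗ[ℝ] ℂ) (v : Fin (p + (q + r)) → E) :
    altWedge (altWedge a b) c (fun i => v (Fin.cast (add_assoc p q r) i)) =
      altWedge a (altWedge b c) v := by
  conv_lhs => rw [altWedge_eq a b, ← alternatization_unalt c, ← alternatization_tensorMul]
  conv_rhs => rw [altWedge_eq b c, ← alternatization_unalt a, ← alternatization_tensorMul]
  refine alternatization_cast _ _ _ (fun v => ?_) v
  simp only [tensorMul_apply, mul_assoc]
  have h (i : Fin r) : Fin.cast (add_assoc p q r) (Fin.natAdd (p + q) i) =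
      Fin.natAdd p (Fin.natAdd q i) := Fin.ext (add_assoc p q i)
  simp only [h]
  rfl

/-- The constant form of degree zero. -/
def altOne : E [⋀^Fin 0]→ₗ[ℝ] ℂ := AlternatingMap.constOfIsEmpty ℝ E (Fin 0) 1

theorem altOne_wedge {p : ℕ} (a : E [⋀^Fin p]→ₗ[ℝ] ℂ) (v : Fin p → E) :
    altWedge altOne a (fun i => v (Fin.cast (zero_add p) i)) = a v := by
  rw [← alternatization_unalt a, show (altOne : E [⋀^Fin 0]→ₗ[ℝ] ℂ) =
    MultilinearMap.alternatization (unalt altOne) from (alternatization_unalt _).symm,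
    ← alternatization_tensorMul]
  refine alternatization_cast _ _ _ (fun v => ?_) v
  simp only [tensorMul_apply, unalt_apply, altOne]
  simp

theorem altWedge_one {p : ℕ} (a : E [⋀^Fin p]→ₗ[ℝ] ℂ) (v : Fin p → E) :
    altWedge a altOne (fun i => v (Fin.cast (add_zero p) i)) = a v := by
  rw [← alternatization_unalt a, show (altOne : E [⋀^Fin 0]→ₗ[ℝ] ℂ) =
    MultilinearMap.alternatization (unalt altOne) from (alternatization_unalt _).symm,
    ← alternatization_tensorMul]
  refine alternatization_cast _ _ _ (fun v => ?_) v
  simp only [tensorMul_apply, unalt_apply, altOne]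
  simp

theorem altWedge_add_left {p q : ℕ} (a a' : E [⋀^Fin p]→ₗ[ℝ] ℂ) (b : E [⋀^Fin q]→ₗ[ℝ] ℂ) :
    altWedge (a + a') b = altWedge a b + altWedge a' b := by
  ext v
  simp only [altWedge_apply, AlternatingMap.add_apply, add_mul, smul_add, Finset.sum_add_distrib]

theorem altWedge_add_right {p q : ℕ} (a : E [⋀^Fin p]→ₗ[ℝ] ℂ) (b b' : E [⋀^Fin q]→ₗ[ℝ] ℂ) :
    altWedge a (b + b') = altWedge a b + altWedge a b' := by
  ext v
  simp only [altWedge_apply, AlternatingMap.add_apply, mul_add, smul_add, Finset.sum_add_distrib]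

theorem altWedge_smul_left {p q : ℕ} (c : ℂ) (a : E [⋀^Fin p]→ₗ[ℝ] ℂ) (b : E [⋀^Fin q]→ₗ[ℝ] ℂ) :
    altWedge (c • a) b = c • altWedge a b := by
  ext v
  simp only [altWedge_apply, AlternatingMap.smul_apply, smul_mul_assoc, Finset.smul_sum]
  exact Finset.sum_congr rfl fun σ _ => by rw [smul_comm _ c, smul_comm _ c]

theorem altWedge_smul_right {p q : ℕ} (c : ℂ) (a : E [⋀^Fin p]→ₗ[ℝ] ℂ)
    (b : E [⋀^Fin q]→ₗ[ℝ] ℂ) :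
    altWedge a (c • b) = c • altWedge a b := by
  ext v
  simp only [altWedge_apply, AlternatingMap.smul_apply, mul_smul_comm, Finset.smul_sum]
  exact Finset.sum_congr rfl fun σ _ => by rw [smul_comm _ c, smul_comm _ c]

instance : GradedMonoid.GMul fun p : ℕ => E [⋀^Fin p]→ₗ[ℝ] ℂ where
  mul a b := altWedge a b

instance : GradedMonoid.GOne fun p : ℕ => E [⋀^Fin p]→ₗ[ℝ] ℂ where
  one := altOne

instance : GradedMonoid.GMonoid fun p : ℕ => E [⋀^Fin p]→ₗ[ℝ] ℂ where
  one_mul a := gradedMonoid_eq (zero_add _) (altOne_wedge a.2)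
  mul_one a := gradedMonoid_eq (add_zero _) (altWedge_one a.2)
  mul_assoc a b c := gradedMonoid_eq (add_assoc _ _ _) (altWedge_assoc a.2 b.2 c.2)

/-- In the direct sum, forms whose degrees are equal only propositionally can be compared directly,
so powers and reorderings obey ordinary ring algebra. -/
instance : DirectSum.GRing fun p : ℕ => E [⋀^Fin p]→ₗ[ℝ] ℂ where
  mul_zero {i j} a := by
    have := altWedge_smul_right 0 a (0 : E [⋀^Fin j]→ₗ[ℝ] ℂ)
    rwa [zero_smul, zero_smul] at this
  zero_mul {i j} b := by
    have := altWedge_smul_left 0 (0 : E [⋀^Fin i]→ₗ[ℝ] ℂ) b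
    rwa [zero_smul, zero_smul] at this
  mul_add := altWedge_add_right
  add_mul := altWedge_add_left
  natCast n := n • altOne
  natCast_zero := zero_smul _ _
  natCast_succ n := by rw [add_smul, one_smul]; try rfl
  intCast n := n • altOne
  intCast_ofNat n := natCast_zsmul _ _
  intCast_negSucc_ofNat n := by rw [Int.negSucc_eq, neg_smul]; rfl

variable (E) in
/-- The ring of alternating forms of all degrees. -/
abbrev FormRing := DirectSum ℕ fun p : ℕ => E [⋀^Fin p]→ₗ[ℝ] ℂ

/-- A homogeneous form as an element of the ring of forms. -/
def FormRing.of {p : ℕ} (a : E [⋀^Fin p]→ₗ[ℝ] ℂ) : FormRing E :=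
  DirectSum.of (fun p : ℕ => E [⋀^Fin p]→ₗ[ℝ] ℂ) p a

theorem FormRing.of_mul {p q : ℕ} (a : E [⋀^Fin p]→ₗ[ℝ] ℂ) (b : E [⋀^Fin q]→ₗ[ℝ] ℂ) :
    of a * of b = of (altWedge a b) :=
  DirectSum.of_mul_of (A := fun p : ℕ => E [⋀^Fin p]→ₗ[ℝ] ℂ) a b

theorem FormRing.of_one : of (altOne : E [⋀^Fin 0]→ₗ[ℝ] ℂ) = 1 := rfl

theorem FormRing.of_add {p : ℕ} (a b : E [⋀^Fin p]→ₗ[ℝ] ℂ) : of (a + b) = of a + of b :=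
  map_add _ a b

theorem FormRing.of_nsmul {p : ℕ} (n : ℕ) (a : E [⋀^Fin p]→ₗ[ℝ] ℂ) : of (n • a) = n • of a :=
  map_nsmul _ n a

theorem FormRing.of_injective {p : ℕ} :
    Function.Injective (of : (E [⋀^Fin p]→ₗ[ℝ] ℂ) → FormRing E) :=
  DirectSum.of_injective (β := fun p : ℕ => E [⋀^Fin p]→ₗ[ℝ] ℂ) p

theorem FormRing.of_eq_of {p q : ℕ} {a : E [⋀^Fin p]→ₗ[ℝ] ℂ} {b : E [⋀^Fin q]→ₗ[ℝ] ℂ} (h : p = q) :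
    of a = of b ↔ ∀ v : Fin q → E, a (fun i => v (Fin.cast h i)) = b v := by
  subst h
  constructor
  · intro hab v
    rw [of_injective hab]
    rfl
  · intro hab
    congr 1
    ext v
    exact hab v

theorem alternatization_domDomCongr {p : ℕ} (f : MultilinearMap ℝ (fun _ : Fin p => E) ℂ)
    (τ : Equiv.Perm (Fin p)) :
    MultilinearMap.alternatization (f.domDomCongr τ) =
      (Equiv.Perm.sign τ : ℤ) • MultilinearMap.alternatization f := by
  ext v
  rw [alternatization_apply', AlternatingMap.smul_apply, alternatization_apply',
    ← Equiv.sum_comp (Equiv.mulRight τ⁻¹), Finset.smul_sum]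
  refine Finset.sum_congr rfl fun σ _ => ?_
  simp [Equiv.Perm.sign_mul, mul_comm, mul_assoc]

/-- Forms of degree two are central. -/
theorem FormRing.of_two_comm {q : ℕ} (a : E [⋀^Fin 2]→ₗ[ℝ] ℂ) (b : E [⋀^Fin q]→ₗ[ℝ] ℂ) :
    of a * of b = of b * of a := by
  rw [of_mul, of_mul, of_eq_of (add_comm 2 q)]
  intro v
  rw [altWedge_eq a b, altWedge_eq b a]
  -- Moving two arguments past `q` others is the square of the cyclic rotation, hence an even
  -- permutation for every `q`.
  have hs : Equiv.Perm.sign (finRotate (q + 2) * finRotate (q + 2)) = 1 := by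
    rw [Equiv.Perm.sign_mul, Int.units_mul_self]
  have key := alternatization_domDomCongr (tensorMul (unalt b) (unalt a))
    (finRotate (q + 2) * finRotate (q + 2))
  rw [hs, Units.val_one, one_smul] at key
  rw [← key]
  refine alternatization_cast _ _ _ (fun v => ?_) v
  rw [MultilinearMap.domDomCongr_apply, tensorMul_apply, tensorMul_apply, mul_comm]
  have hv (i : Fin (q + 2)) :
      ((finRotate (q + 2) * finRotate (q + 2)) i : ℕ) = (i + 2) % (q + 2) := by
    simp only [Equiv.Perm.mul_apply, finRotate_apply, Fin.val_add, Fin.val_one,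
      Nat.mod_add_mod]
  congr 2 <;> refine funext fun i => congrArg v (Fin.ext ?_) <;> rw [hv]
  · rw [Nat.mod_eq_of_lt (by simp)]
    simp
  · simp only [Fin.val_cast, Fin.val_castAdd, Fin.val_natAdd]
    rw [show q + (i : ℕ) + 2 = i + (q + 2) by ring, Nat.add_mod_right, Nat.mod_eq_of_lt (by omega)]

theorem FormRing.commute_of_two (a : E [⋀^Fin 2]→ₗ[ℝ] ℂ) (x : FormRing E) : Commute (of a) x := by
  induction x using DirectSum.induction_on with
  | zero => exact Commute.zero_right _
  | of i x => exact of_two_comm a x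
  | add x y hx hy => exact hx.add_right hy

end FormAlgebra

/-! ### Antisymmetrization of a family of forms and its compatibility with the wedge product. -/

section Uncurry

variable {E : Type*} [AddCommGroup E] [Module ℝ E]

/-- The permutation of `Fin (n + 1)` sending `0` to `i` and `j.succ` to `i.succAbove (τ j)`. -/
def insertPerm {n : ℕ} (i : Fin (n + 1)) (τ : Equiv.Perm (Fin n)) : Equiv.Perm (Fin (n + 1)) :=
  i.cycleRange.symm * Equiv.Perm.decomposeFin.symm (0, τ)

theorem insertPerm_zero {n : ℕ} (i : Fin (n + 1)) (τ : Equiv.Perm (Fin n)) :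
    insertPerm i τ 0 = i := by
  simp [insertPerm]

theorem insertPerm_succ {n : ℕ} (i : Fin (n + 1)) (τ : Equiv.Perm (Fin n)) (j : Fin n) :
    insertPerm i τ j.succ = i.succAbove (τ j) := by
  simp [insertPerm]

theorem sign_insertPerm {n : ℕ} (i : Fin (n + 1)) (τ : Equiv.Perm (Fin n)) :
    Equiv.Perm.sign (insertPerm i τ) = (-1) ^ (i : ℕ) * Equiv.Perm.sign τ := by
  rw [insertPerm, Equiv.Perm.sign_mul, Equiv.Perm.sign_symm, Fin.sign_cycleRange,
    Equiv.Perm.decomposeFin.symm_sign]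
  simp

theorem insertPerm_bijective (n : ℕ) :
    Function.Bijective fun x : Fin (n + 1) × Equiv.Perm (Fin n) => insertPerm x.1 x.2 := by
  rw [Fintype.bijective_iff_injective_and_card]
  refine ⟨fun ⟨i, τ⟩ ⟨j, ρ⟩ h => ?_, ?_⟩
  · simp only at h
    have hij : i = j := by rw [← insertPerm_zero i τ, h, insertPerm_zero]
    subst hij
    have : τ = ρ := by
      ext k
      have := congrArg (fun σ : Equiv.Perm _ => σ k.succ) h
      simp only [insertPerm_succ] at this
      rw [Fin.succAbove_right_injective this]
    rw [this]
  · simp [Fintype.card_perm, Nat.factorial_succ]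

theorem sum_perm_succ {n : ℕ} {A : Type*} [AddCommMonoid A] (f : Equiv.Perm (Fin (n + 1)) → A) :
    ∑ σ, f σ = ∑ i : Fin (n + 1), ∑ τ : Equiv.Perm (Fin n), f (insertPerm i τ) := by
  rw [← (insertPerm_bijective n).sum_comp, Fintype.sum_prod_type]

/-- Choosing the argument for the first slot and then permuting the remaining ones runs through
every permutation once, with matching signs. -/
theorem alternatizeUncurryFin_alternatization {p : ℕ}
    (h : E →ₗ[ℝ] MultilinearMap ℝ (fun _ : Fin p => E) ℂ) (f : E →ₗ[ℝ] E [⋀^Fin p]→ₗ[ℝ] ℂ)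
    (hf : ∀ v, f v = MultilinearMap.alternatization (h v)) :
    AlternatingMap.alternatizeUncurryFin f = MultilinearMap.alternatization h.uncurryLeft := by
  ext v
  rw [AlternatingMap.alternatizeUncurryFin_apply, alternatization_apply', sum_perm_succ]
  refine Finset.sum_congr rfl fun i _ => ?_
  rw [hf, alternatization_apply', Finset.smul_sum]
  refine Finset.sum_congr rfl fun τ _ => ?_
  rw [sign_insertPerm, LinearMap.uncurryLeft_apply, insertPerm_zero, smul_smul]
  have ht : (Fin.tail fun j => v (insertPerm i τ j)) = fun j => i.removeNth v (τ j) :=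
    funext fun j => congrArg v (insertPerm_succ i τ j)
  rw [ht]
  simp

/-- The family of multilinear forms with alternatizations `f v`. -/
def unaltL {p : ℕ} (f : E →ₗ[ℝ] E [⋀^Fin p]→ₗ[ℝ] ℂ) :
    E →ₗ[ℝ] MultilinearMap ℝ (fun _ : Fin p => E) ℂ where
  toFun v := unalt (f v)
  map_add' u v := by ext w; simp [unalt_apply]
  map_smul' c v := by ext w; simp [unalt_apply, mul_left_comm]

theorem alternatizeUncurryFin_eq {p : ℕ} (f : E →ₗ[ℝ] E [⋀^Fin p]→ₗ[ℝ] ℂ) :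
    AlternatingMap.alternatizeUncurryFin f =
      MultilinearMap.alternatization (unaltL f).uncurryLeft :=
  alternatizeUncurryFin_alternatization _ _ fun v => (alternatization_unalt (f v)).symm

/-- Antisymmetrization of `v ↦ β(v) ∧ b` is the wedge product with `b` of the antisymmetrization
of `β`. -/
theorem FormRing.of_alternatizeUncurryFin_mul {p q r : ℕ} (f : E →ₗ[ℝ] E [⋀^Fin p]→ₗ[ℝ] ℂ)
    (b : E [⋀^Fin q]→ₗ[ℝ] ℂ) (g : E →ₗ[ℝ] E [⋀^Fin r]→ₗ[ℝ] ℂ) 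
    (hg : ∀ v, of (g v) = of (f v) * of b) (hr : r = p + q) :
    of (AlternatingMap.alternatizeUncurryFin g) =
      of (AlternatingMap.alternatizeUncurryFin f) * of b := by
  subst hr
  let h : E →ₗ[ℝ] MultilinearMap ℝ (fun _ : Fin (p + q) => E) ℂ :=
    { toFun v := tensorMul (unaltL f v) (unalt b)
      map_add' u v := by ext w; simp [tensorMul_apply, add_mul]
      map_smul' c v := by ext w; simp [tensorMul_apply, mul_assoc] }
  rw [alternatizeUncurryFin_alternatization h g, of_mul, altWedge_eq,
    of_eq_of (show p + q + 1 = p + 1 + q by omega)]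
  · intro v
    rw [← altWedge_eq, ← alternatization_unalt b, alternatizeUncurryFin_eq,
      ← alternatization_tensorMul]
    refine alternatization_cast _ _ _ (fun v => ?_) v
    rw [LinearMap.uncurryLeft_apply, tensorMul_apply, LinearMap.uncurryLeft_apply]
    change tensorMul (unaltL f _) (unalt b) _ = _
    rw [tensorMul_apply]
    congr 2
    refine funext fun i => congrArg v (Fin.ext ?_)
    change p + i + 1 = p + 1 + i
    ring
  · intro v
    apply of_injective
    rw [hg, of_mul, altWedge_eq]
    rfl

end Uncurry

/-! ### The wedge product as a bounded bilinear map, and the Leibniz rule on a vector space. -/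

section FlatCalculus

variable {E : Type*} [NormedAddCommGroup E] [NormedSpace ℂ E]

theorem wedge_apply {p q : ℕ} (a : E [⋀^Fin p]→L[ℝ] ℂ) (b : E [⋀^Fin q]→L[ℝ] ℂ)
    (v : Fin (p + q) → E) :
    wedge a b v = ((p.factorial : ℝ)⁻¹ * (q.factorial : ℝ)⁻¹ : ℝ) •
      ∑ σ : Equiv.Perm (Fin (p + q)), (Equiv.Perm.sign σ : ℤ) •
        (a (fun i => v (σ (Fin.castAdd q i))) * b (fun i => v (σ (Fin.natAdd p i)))) :=
  altWedge_apply a.toAlternatingMap b.toAlternatingMap v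

/-- Boundedness makes the product rule for Fréchet derivatives available. The constant counts all
`(p + q)!` permutations, each term being bounded separately. -/
theorem norm_wedge_apply_le {p q : ℕ} (a : E [⋀^Fin p]→L[ℝ] ℂ) (b : E [⋀^Fin q]→L[ℝ] ℂ)
    (v : Fin (p + q) → E) :
    ‖wedge a b v‖ ≤ ((p.factorial : ℝ)⁻¹ * (q.factorial : ℝ)⁻¹ * (p + q).factorial) *
      ‖a‖ * ‖b‖ * ∏ i, ‖v i‖ := by
  rw [wedge_apply, norm_smul, Real.norm_of_nonneg (by positivity)]
  have h (σ : Equiv.Perm (Fin (p + q))) : ‖(Equiv.Perm.sign σ : ℤ) •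
        (a (fun i => v (σ (Fin.castAdd q i))) * b (fun i => v (σ (Fin.natAdd p i))))‖ ≤
      ‖a‖ * ‖b‖ * ∏ i, ‖v i‖ := by
    have h1 := a.le_opNorm fun i => v (σ (Fin.castAdd q i))
    have h2 := b.le_opNorm fun i => v (σ (Fin.natAdd p i))
    have h3 : ∏ i, ‖v i‖ =
        (∏ i, ‖v (σ (Fin.castAdd q i))‖) * ∏ i, ‖v (σ (Fin.natAdd p i))‖ := by
      rw [← Fin.prod_univ_add (fun i => ‖v (σ i)‖), Equiv.prod_comp σ fun i => ‖v i‖]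
    rw [norm_isUnit_zsmul _ (Units.isUnit _), norm_mul, h3, mul_mul_mul_comm]
    gcongr
  calc _ ≤ ((p.factorial : ℝ)⁻¹ * (q.factorial : ℝ)⁻¹) *
        ∑ _σ : Equiv.Perm (Fin (p + q)), ‖a‖ * ‖b‖ * ∏ i, ‖v i‖ := by
        gcongr
        exact norm_sum_le_of_le _ fun σ _ => h σ
    _ = _ := by
        rw [Finset.sum_const, Finset.card_univ, Fintype.card_perm, Fintype.card_fin,
          nsmul_eq_mul]
        ring

theorem wedge_add_left {p q : ℕ} (a a' : E [⋀^Fin p]→L[ℝ] ℂ) (b : E [⋀^Fin q]→L[ℝ] ℂ) :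
    wedge (a + a') b = wedge a b + wedge a' b := by
  ext v
  simp only [wedge_apply, ContinuousAlternatingMap.add_apply, add_mul, smul_add,
    Finset.sum_add_distrib]

theorem wedge_add_right {p q : ℕ} (a : E [⋀^Fin p]→L[ℝ] ℂ) (b b' : E [⋀^Fin q]→L[ℝ] ℂ) :
    wedge a (b + b') = wedge a b + wedge a b' := by
  ext v
  simp only [wedge_apply, ContinuousAlternatingMap.add_apply, mul_add, smul_add,
    Finset.sum_add_distrib]

theorem wedge_smul_left {p q : ℕ} (c : ℂ) (a : E [⋀^Fin p]→L[ℝ] ℂ) (b : E [⋀^Fin q]→L[ℝ] ℂ) :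
    wedge (c • a) b = c • wedge a b := by
  ext v
  simp only [wedge_apply, ContinuousAlternatingMap.smul_apply, smul_mul_assoc, Finset.smul_sum]
  exact Finset.sum_congr rfl fun σ _ => by rw [smul_comm _ c, smul_comm _ c]

theorem wedge_smul_right {p q : ℕ} (c : ℂ) (a : E [⋀^Fin p]→L[ℝ] ℂ) (b : E [⋀^Fin q]→L[ℝ] ℂ) :
    wedge a (c • b) = c • wedge a b := by
  ext v
  simp only [wedge_apply, ContinuousAlternatingMap.smul_apply, mul_smul_comm, Finset.smul_sum]
  exact Finset.sum_congr rfl fun σ _ => by rw [smul_comm _ c, smul_comm _ c]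

theorem ofReal_smul_form {p : ℕ} (c : ℝ) (a : E [⋀^Fin p]→L[ℝ] ℂ) : (c : ℂ) • a = c • a := by
  ext v
  simp

variable (E) in
/-- The wedge product as a continuous bilinear map. -/
def wedgeL (p q : ℕ) :
    (E [⋀^Fin p]→L[ℝ] ℂ) →L[ℝ] (E [⋀^Fin q]→L[ℝ] ℂ) →L[ℝ] (E [⋀^Fin (p + q)]→L[ℝ] ℂ) :=
  LinearMap.mkContinuous₂
    (LinearMap.mk₂ ℝ wedge wedge_add_left
      (fun c a b => by simpa only [ofReal_smul_form] using wedge_smul_left (c : ℂ) a b) wedge_add_right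
      (fun c a b => by simpa only [ofReal_smul_form] using wedge_smul_right (c : ℂ) a b))
    ((p.factorial : ℝ)⁻¹ * (q.factorial : ℝ)⁻¹ * (p + q).factorial)
    fun a b => ContinuousAlternatingMap.opNorm_le_bound _ (by positivity)
      (norm_wedge_apply_le a b)

@[simp]
theorem wedgeL_apply {p q : ℕ} (a : E [⋀^Fin p]→L[ℝ] ℂ) (b : E [⋀^Fin q]→L[ℝ] ℂ) :
    wedgeL E p q a b = wedge a b := rfl

/-- A continuous form as an element of the ring of forms. -/
def toRing {p : ℕ} (a : E [⋀^Fin p]→L[ℝ] ℂ) : FormRing E := FormRing.of a.toAlternatingMap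

theorem toRing_injective {p : ℕ} :
    Function.Injective (toRing : (E [⋀^Fin p]→L[ℝ] ℂ) → FormRing E) :=
  FormRing.of_injective.comp ContinuousAlternatingMap.toAlternatingMap_injective

theorem toRing_wedge {p q : ℕ} (a : E [⋀^Fin p]→L[ℝ] ℂ) (b : E [⋀^Fin q]→L[ℝ] ℂ) :
    toRing (wedge a b) = toRing a * toRing b :=
  (FormRing.of_mul _ _).symm

theorem toRing_add {p : ℕ} (a b : E [⋀^Fin p]→L[ℝ] ℂ) : toRing (a + b) = toRing a + toRing b :=
  FormRing.of_add a.toAlternatingMap b.toAlternatingMap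

theorem toRing_nsmul {p : ℕ} (n : ℕ) (a : E [⋀^Fin p]→L[ℝ] ℂ) : toRing (n • a) = n • toRing a :=
  FormRing.of_nsmul n a.toAlternatingMap

theorem toRing_zero {p : ℕ} : toRing (0 : E [⋀^Fin p]→L[ℝ] ℂ) = 0 := by
  simpa using toRing_nsmul 0 (0 : E [⋀^Fin p]→L[ℝ] ℂ)

theorem toRing_eq_iff {p q : ℕ} {a : E [⋀^Fin p]→L[ℝ] ℂ} {b : E [⋀^Fin q]→L[ℝ] ℂ} (h : p = q) :
    toRing a = toRing b ↔ ∀ v : Fin q → E, a (fun i => v (Fin.cast h i)) = b v :=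
  FormRing.of_eq_of h

theorem toRing_wedgePow (a : E [⋀^Fin 2]→L[ℝ] ℂ) (k : ℕ) :
    toRing (wedgePow a k) = toRing a ^ k := by
  induction k with
  | zero => exact FormRing.of_one
  | succ k ih => rw [pow_succ, ← ih]; exact toRing_wedge _ _

theorem commute_toRing (a : E [⋀^Fin 2]→L[ℝ] ℂ) (x : FormRing E) : Commute (toRing a) x :=
  FormRing.commute_of_two _ x

variable (E) in
/-- Antisymmetrization of `v ↦ a D(v) + b D(iv)`. -/
def twist (a b : ℂ) (p : ℕ) : (E →L[ℝ] E [⋀^Fin p]→L[ℝ] ℂ) →L[ℝ] E [⋀^Fin (p + 1)]→L[ℝ] ℂ :=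
  (ContinuousAlternatingMap.alternatizeUncurryFinCLM ℝ E ℂ).comp
    (a • ContinuousLinearMap.id ℝ _ + b • ContinuousLinearMap.precomp _ (mulI E))

theorem twist_apply {p : ℕ} (a b : ℂ) (D : E →L[ℝ] E [⋀^Fin p]→L[ℝ] ℂ) :
    twist E a b p D =
      ContinuousAlternatingMap.alternatizeUncurryFin (a • D + b • D.comp (mulI E)) := rfl

/-- A statement about `twist` for arbitrary `a`, `b` covers `∂` at `(1/2, -i/2)`, `∂̄` at `(1/2,
i/2)` and `d` at `(1, 0)` at once. -/
theorem flatDel_eq_twist {p : ℕ} (α : E → E [⋀^Fin p]→L[ℝ] ℂ) (x : E) :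
    flatDel α x = twist E (1 / 2) (-(Complex.I / 2)) p (fderiv ℝ α x) := by
  rw [flatDel, twist_apply]
  congr 1
  ext v w
  simp
  ring

theorem flatDelbar_eq_twist {p : ℕ} (α : E → E [⋀^Fin p]→L[ℝ] ℂ) (x : E) :
    flatDelbar α x = twist E (1 / 2) (Complex.I / 2) p (fderiv ℝ α x) := by
  rw [flatDelbar, twist_apply]
  congr 1
  ext v w
  simp
  ring

theorem contDiffOn_twist {p : ℕ} (a b : ℂ) {α : E → E [⋀^Fin p]→L[ℝ] ℂ} {U : Set E}
    (hU : IsOpen U) (hα : ContDiffOn ℝ ∞ α U) :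
    ContDiffOn ℝ ∞ (fun x => twist E a b p (fderiv ℝ α x)) U :=
  (twist E a b p).contDiff.comp_contDiffOn (hα.fderiv_of_isOpen hU (by simp))

theorem toRing_twist_mul {p q r : ℕ} (a b : ℂ) (D : E →L[ℝ] E [⋀^Fin p]→L[ℝ] ℂ)
    (η : E [⋀^Fin q]→L[ℝ] ℂ) (D' : E →L[ℝ] E [⋀^Fin r]→L[ℝ] ℂ) (hr : r = p + q)
    (h : ∀ v, toRing (D' v) = toRing (D v) * toRing η) :
    toRing (twist E a b r D') = toRing (twist E a b p D) * toRing η := by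
  subst hr
  have h' (v : E) : D' v = wedge (D v) η := toRing_injective (by rw [h, toRing_wedge])
  rw [twist_apply, twist_apply, toRing, toRing,
    ContinuousAlternatingMap.toAlternatingMap_alternatizeUncurryFin,
    ContinuousAlternatingMap.toAlternatingMap_alternatizeUncurryFin]
  refine FormRing.of_alternatizeUncurryFin_mul _ _ _ (fun v => ?_) rfl
  change toRing (a • D' v + b • D' (mulI E v)) = toRing (a • D v + b • D (mulI E v)) * toRing η
  rw [← toRing_wedge, h', h', wedge_add_left, wedge_smul_left, wedge_smul_left]

theorem fderiv_wedge {p q : ℕ} {α : E → E [⋀^Fin p]→L[ℝ] ℂ} {β : E → E [⋀^Fin q]→L[ℝ] ℂ} {x : E}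
    (hα : DifferentiableAt ℝ α x) (hβ : DifferentiableAt ℝ β x) (v : E) :
    fderiv ℝ (fun y => wedge (α y) (β y)) x v =
      wedge (α x) (fderiv ℝ β x v) + wedge (fderiv ℝ α x v) (β x) := by
  have := ((wedgeL E p q).hasFDerivAt_of_bilinear hα.hasFDerivAt hβ.hasFDerivAt).fderiv
  simp only [wedgeL_apply] at this
  rw [this]
  rfl

/-- A Leibniz rule without signs: the differentiating slot comes first, and `hcomm` moves the
derivative of `β` in front of `α`. In the applications `β` is a power of a two-form, while `α` may
have odd degree. -/
theorem toRing_twist_fderiv_wedge {p q : ℕ} (a b : ℂ) {α : E → E [⋀^Fin p]→L[ℝ] ℂ}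
    {β : E → E [⋀^Fin q]→L[ℝ] ℂ} {x : E}
    (hα : DifferentiableAt ℝ α x) (hβ : DifferentiableAt ℝ β x)
    (hcomm : ∀ v, Commute (toRing (α x)) (toRing (fderiv ℝ β x v))) :
    toRing (twist E a b _ (fderiv ℝ (fun y => wedge (α y) (β y)) x)) =
      toRing (twist E a b _ (fderiv ℝ α x)) * toRing (β x) +
        toRing (twist E a b _ (fderiv ℝ β x)) * toRing (α x) := by
  have hsum : fderiv ℝ (fun y => wedge (α y) (β y)) x =
      (wedgeL E p q (α x)).comp (fderiv ℝ β x) +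
        ((wedgeL E p q).flip (β x)).comp (fderiv ℝ α x) := by
    ext1 v
    rw [fderiv_wedge hα hβ]
    rfl
  rw [hsum, map_add, toRing_add, add_comm]
  congr 1
  · exact toRing_twist_mul a b _ _ _ rfl fun v => toRing_wedge _ _
  · exact toRing_twist_mul a b _ _ _ (add_comm p q) fun v =>
      (toRing_wedge _ _).trans (hcomm v).eq

theorem differentiableAt_wedge {p q : ℕ} {α : E → E [⋀^Fin p]→L[ℝ] ℂ}
    {β : E → E [⋀^Fin q]→L[ℝ] ℂ} {x : E}
    (hα : DifferentiableAt ℝ α x) (hβ : DifferentiableAt ℝ β x) :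
    DifferentiableAt ℝ (fun y => wedge (α y) (β y)) x :=
  ((wedgeL E p q).hasFDerivAt_of_bilinear hα.hasFDerivAt hβ.hasFDerivAt).differentiableAt

end FlatCalculus

/-! ### Derivatives of powers of a two-form. -/

section WedgePowCalculus

variable {E : Type*} [NormedAddCommGroup E] [NormedSpace ℂ E]

theorem contDiffOn_wedge {p q : ℕ} {α : E → E [⋀^Fin p]→L[ℝ] ℂ}
    {β : E → E [⋀^Fin q]→L[ℝ] ℂ} {U : Set E}
    (hα : ContDiffOn ℝ ∞ α U) (hβ : ContDiffOn ℝ ∞ β U) :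
    ContDiffOn ℝ ∞ (fun y => wedge (α y) (β y)) U := by
  have hL : ContDiff ℝ ∞ fun a => wedgeL E p q a := by fun_prop
  have h : ContDiffOn ℝ ∞ (fun y => wedgeL E p q (α y) (β y)) U :=
    ContDiffOn.clm_apply (f := fun y => wedgeL E p q (α y)) (hL.comp_contDiffOn hα) hβ
  exact h

theorem contDiffOn_wedgePow {φ : E → E [⋀^Fin 2]→L[ℝ] ℂ} {U : Set E} (hφ : ContDiffOn ℝ ∞ φ U)
    (k : ℕ) : ContDiffOn ℝ ∞ (fun y => wedgePow (φ y) k) U := by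
  induction k with
  | zero => exact contDiffOn_const
  | succ k ih => exact contDiffOn_wedge ih hφ

theorem differentiableAt_wedgePow {φ : E → E [⋀^Fin 2]→L[ℝ] ℂ} {x : E}
    (hφ : DifferentiableAt ℝ φ x) (k : ℕ) :
    DifferentiableAt ℝ (fun y => wedgePow (φ y) k) x := by
  induction k with
  | zero => exact differentiableAt_const _
  | succ k ih => exact differentiableAt_wedge ih hφ

/-- The derivative of a power is a sum of products of two-forms, and these are central. -/
theorem commute_toRing_fderiv_wedgePow {φ : E → E [⋀^Fin 2]→L[ℝ] ℂ} {x : E}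
    (hφ : DifferentiableAt ℝ φ x) (k : ℕ) (v : E) (r : FormRing E) :
    Commute (toRing (fderiv ℝ (fun y => wedgePow (φ y) k) x v)) r := by
  induction k with
  | zero =>
    have : fderiv ℝ (fun y => wedgePow (φ y) 0) x = 0 := fderiv_const_apply _
    rw [this, zero_apply, toRing_zero]
    exact Commute.zero_left r
  | succ k ih =>
    have : fderiv ℝ (fun y => wedgePow (φ y) (k + 1)) x v = _ :=
      fderiv_wedge (differentiableAt_wedgePow hφ k) hφ v
    rw [this]
    rw [toRing_add]
    refine Commute.add_left ?_ ?_
    · rw [toRing_wedge, toRing_wedgePow]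
      exact ((commute_toRing _ _).pow_left k).mul_left (commute_toRing _ _)
    · rw [toRing_wedge]
      exact ih.mul_left (commute_toRing _ _)

/-- The truncated exponent `k - 1` at `k = 0` is harmless because its coefficient is zero. -/
theorem toRing_twist_wedgePow (a b : ℂ) {φ : E → E [⋀^Fin 2]→L[ℝ] ℂ} {x : E}
    (hφ : DifferentiableAt ℝ φ x) (k : ℕ) :
    toRing (twist E a b _ (fderiv ℝ (fun y => wedgePow (φ y) k) x)) =
      k • (toRing (twist E a b _ (fderiv ℝ φ x)) * toRing (φ x) ^ (k - 1)) := by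
  induction k with
  | zero =>
    have : fderiv ℝ (fun y => wedgePow (φ y) 0) x = 0 := fderiv_const_apply _
    rw [this, map_zero, zero_smul, toRing_zero]
  | succ k ih =>
    have h := toRing_twist_fderiv_wedge a b (differentiableAt_wedgePow hφ k) hφ
      fun v => (commute_toRing _ _).symm
    refine Eq.trans h ?_
    rw [ih, toRing_wedgePow, add_smul, one_smul, Nat.add_sub_cancel]
    congr 1
    rcases k with _ | k
    · simp
    · rw [smul_mul_assoc, mul_assoc, ← pow_succ, Nat.add_sub_cancel]

theorem toRing_twist_congr {p q : ℕ} (h : p = q) (a b : ℂ) {α : E → E [⋀^Fin p]→L[ℝ] ℂ}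
    {β : E → E [⋀^Fin q]→L[ℝ] ℂ} {x : E} (hαβ : ∀ᶠ y in nhds x, toRing (α y) = toRing (β y)) :
    toRing (twist E a b _ (fderiv ℝ α x)) = toRing (twist E a b _ (fderiv ℝ β x)) := by
  subst h
  rw [Filter.EventuallyEq.fderiv_eq (hαβ.mono fun y hy => toRing_injective hy)]

/-- `∂∂̄(φ ^ k) = k ∂∂̄φ ∧ φ ^ (k - 1) + k (k - 1) ∂φ ∧ φ ^ (k - 2) ∧ ∂̄φ`. -/
theorem toRing_flatDel_flatDelbar_wedgePow {φ : E → E [⋀^Fin 2]→L[ℝ] ℂ} {U : Set E} {x : E}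
    (hU : IsOpen U) (hφ : ContDiffOn ℝ ∞ φ U) (hx : x ∈ U) (k : ℕ) :
    toRing (flatDel (flatDelbar fun y => wedgePow (φ y) (k + 1)) x) =
      (k + 1) • (toRing (flatDel (flatDelbar φ) x) * toRing (φ x) ^ k) +
        ((k + 1) * k) •
          (toRing (flatDel φ x) * toRing (φ x) ^ (k - 1) * toRing (flatDelbar φ x)) := by
  have hd (y : E) (hy : y ∈ U) : DifferentiableAt ℝ φ y :=
    (hφ.contDiffAt (hU.mem_nhds hy)).differentiableAt (by simp)
  have hdb : DifferentiableAt ℝ (flatDelbar φ) x := by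
    have := contDiffOn_twist (1 / 2) (Complex.I / 2) hU hφ
    simp only [← flatDelbar_eq_twist] at this
    exact (this.contDiffAt (hU.mem_nhds hx)).differentiableAt (by simp)
  have hw := differentiableAt_wedge hdb (differentiableAt_wedgePow (hd x hx) k)
  -- Near `x`, `∂̄(φ ^ (k + 1))` is `(k + 1) ∂̄φ ∧ φ ^ k`. The odd factor stands on the left, so
  -- that the sign-free Leibniz rule applies with the central factor on the right.
  rw [flatDel_eq_twist, flatDel_eq_twist, flatDel_eq_twist,
    toRing_twist_congr (show 2 * (k + 1) + 1 = 2 + 1 + 2 * k by ring)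
      (β := fun y => (k + 1) • wedge (flatDelbar φ y) (wedgePow (φ y) k))]
  · have hs : fderiv ℝ (fun y => (k + 1) • wedge (flatDelbar φ y) (wedgePow (φ y) k)) x =
        (k + 1) • fderiv ℝ (fun y => wedge (flatDelbar φ y) (wedgePow (φ y) k)) x := by
      simp only [← Nat.cast_smul_eq_nsmul ℝ]
      exact fderiv_fun_const_smul hw _
    rw [hs, map_nsmul, toRing_nsmul, toRing_twist_fderiv_wedge _ _ hdb
      (differentiableAt_wedgePow (hd x hx) k)
      fun v => (commute_toRing_fderiv_wedgePow (hd x hx) k v _).symm,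
      toRing_twist_wedgePow _ _ (hd x hx), toRing_wedgePow, smul_add, mul_smul, smul_mul_assoc]
  · filter_upwards [hU.mem_nhds hx] with y hy
    rw [toRing_nsmul, toRing_wedge, toRing_wedgePow, flatDelbar_eq_twist, flatDelbar_eq_twist,
      toRing_twist_wedgePow _ _ (hd y hy), Nat.add_sub_cancel]

end WedgePowCalculus

/-! ### Holomorphic pullback commutes with `∂` and `∂̄` on a vector space. -/

section FlatNaturality

variable {E : Type*} [NormedAddCommGroup E] [NormedSpace ℂ E]

theorem mulI_apply (v : E) : mulI E v = Complex.I • v := rfl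

theorem restrictScalars_comp_mulI (L : E →L[ℂ] E) :
    (L.restrictScalars ℝ).comp (mulI E) = (mulI E).comp (L.restrictScalars ℝ) := by
  ext v
  simp [mulI_apply]

/-- Multiplication by `i` in the differentiating slot alone is multiplication by `i` in all slots,
undone in the others by `-i`. -/
theorem alternatizeUncurryFin_comp_mulI {p : ℕ} (D : E →L[ℝ] E [⋀^Fin p]→L[ℝ] ℂ) :
    ContinuousAlternatingMap.alternatizeUncurryFin (D.comp (mulI E)) =
      (ContinuousAlternatingMap.alternatizeUncurryFin
        ((ContinuousAlternatingMap.compContinuousLinearMapCLM (-mulI E)).comp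
          D)).compContinuousLinearMap (mulI E) := by
  ext v
  have h (i : Fin (p + 1)) :
      (fun j => -mulI E (i.removeNth (mulI E ∘ v) j)) = i.removeNth v := by
    funext j
    simp [Fin.removeNth, mulI_apply, smul_smul]
  simp [ContinuousAlternatingMap.alternatizeUncurryFin_apply, Function.comp_def] at h ⊢
  simp [h]

/-- The antisymmetrized derivative in the direction rotated by `i` is an exterior derivative. -/
theorem alternatizeUncurryFin_fderiv_comp_mulI {p : ℕ} {α : E → E [⋀^Fin p]→L[ℝ] ℂ} {x : E}
    (hα : DifferentiableAt ℝ α x) :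
    ContinuousAlternatingMap.alternatizeUncurryFin ((fderiv ℝ α x).comp (mulI E)) =
      (extDeriv (fun y => (α y).compContinuousLinearMap (-mulI E)) x).compContinuousLinearMap
        (mulI E) := by
  rw [alternatizeUncurryFin_comp_mulI, extDeriv]
  congr 2
  have := (ContinuousAlternatingMap.compContinuousLinearMapCLM (F := ℂ) (ι := Fin p)
    (-mulI E)).hasFDerivAt.comp x hα.hasFDerivAt
  exact this.fderiv.symm

/-- Writes `twist` through `d` and its conjugate by `i`, so that naturality is inherited from
`extDeriv_pullback`. -/
theorem twist_fderiv_eq {p : ℕ} (a b : ℂ) {α : E → E [⋀^Fin p]→L[ℝ] ℂ} {x : E}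
    (hα : DifferentiableAt ℝ α x) :
    twist E a b p (fderiv ℝ α x) = a • extDeriv α x +
      b • (extDeriv (fun y => (α y).compContinuousLinearMap (-mulI E)) x).compContinuousLinearMap
        (mulI E) := by
  rw [twist_apply, ContinuousAlternatingMap.alternatizeUncurryFin_add,
    ContinuousAlternatingMap.alternatizeUncurryFin_smul,
    ContinuousAlternatingMap.alternatizeUncurryFin_smul,
    alternatizeUncurryFin_fderiv_comp_mulI hα]
  rfl

theorem differentiableAt_compMulI {p : ℕ} (L : E →L[ℝ] E) {α : E → E [⋀^Fin p]→L[ℝ] ℂ} {x : E}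
    (hα : DifferentiableAt ℝ α x) :
    DifferentiableAt ℝ (fun y => (α y).compContinuousLinearMap L) x :=
  ((ContinuousAlternatingMap.compContinuousLinearMapCLM (F := ℂ) (ι := Fin p)
    L).hasFDerivAt.comp x hα.hasFDerivAt).differentiableAt

/-- The twisted derivative commutes with the pullback by a holomorphic map. -/
theorem twist_fderiv_pullback {p : ℕ} (a b : ℂ) {α : E → E [⋀^Fin p]→L[ℝ] ℂ} {H : E → E}
    {V : Set E} (hV : IsOpen V) (hH : ContDiffOn ℂ ω H V) {x : E} (hx : x ∈ V)
    (hα : DifferentiableAt ℝ α (H x)) :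
    twist E a b p (fderiv ℝ (fun y => (α (H y)).compContinuousLinearMap (fderiv ℝ H y)) x) =
      (twist E a b p (fderiv ℝ α (H x))).compContinuousLinearMap (fderiv ℝ H x) := by
  have hH' (y : E) (hy : y ∈ V) : ContDiffAt ℂ ω H y := hH.contDiffAt (hV.mem_nhds hy)
  have hR (y : E) (hy : y ∈ V) : ContDiffAt ℝ ω H y := (hH' y hy).restrict_scalars ℝ
  have hf (y : E) (hy : y ∈ V) : fderiv ℝ H y = (fderiv ℂ H y).restrictScalars ℝ :=
    ((hH' y hy).differentiableAt (by simp)).fderiv_restrictScalars ℝ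
  have hd : DifferentiableAt ℝ (fun y => (α (H y)).compContinuousLinearMap (fderiv ℝ H y)) x := by
    refine DifferentiableAt.continuousAlternatingMapCompContinuousLinearMap
      (hα.comp x ((hR x hx).differentiableAt (by simp))) ?_
    exact ((hR x hx).fderiv_right (m := 1) (by simp)).differentiableAt (by simp)
  have hm : minSmoothness ℝ 2 ≤ (ω : WithTop ℕ∞) := by simp
  rw [twist_fderiv_eq a b hd, twist_fderiv_eq a b hα, extDeriv_pullback hα (hR x hx) hm]
  -- The differential of a holomorphic map commutes with multiplication by `i`. This is the only
  -- place where complex linearity enters the naturality.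
  have h1 : (fun y => ((α (H y)).compContinuousLinearMap
        (fderiv ℝ H y)).compContinuousLinearMap (-mulI E)) =ᶠ[nhds x]
      fun y => ((α (H y)).compContinuousLinearMap (-mulI E)).compContinuousLinearMap
        (fderiv ℝ H y) := by
    filter_upwards [hV.mem_nhds hx] with y hy
    ext v
    have h2 := DFunLike.congr_fun (restrictScalars_comp_mulI (fderiv ℂ H y))
    rw [← hf y hy] at h2
    simp only [ContinuousLinearMap.comp_apply] at h2
    simp [Function.comp_def, h2]
  rw [h1.extDeriv_eq, extDeriv_pullback (differentiableAt_compMulI (-mulI E) hα) (hR x hx) hm]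
  ext v
  have h2 := DFunLike.congr_fun (restrictScalars_comp_mulI (fderiv ℂ H x))
  rw [← hf x hx] at h2
  simp only [ContinuousLinearMap.comp_apply] at h2
  simp [Function.comp_def, h2]

end FlatNaturality

/-! ### Holomorphic pullback and chart independence on complex manifolds. -/

section Naturality

variable {E : Type*} [NormedAddCommGroup E] [NormedSpace ℂ E]
  {X : Type*} [TopologicalSpace X] [ChartedSpace E X]
  {M : Type*} [TopologicalSpace M] [ChartedSpace E M]
  {N : Type*} [TopologicalSpace N] [ChartedSpace E N]

theorem realDifferential_comp {g : M → X} {f : N → M} {x : N}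
    (hg : MDifferentiableAt 𝓘(ℂ, E) 𝓘(ℂ, E) g (f x))
    (hf : MDifferentiableAt 𝓘(ℂ, E) 𝓘(ℂ, E) f x) :
    realDifferential (E := E) (fun y => g (f y)) x =
      (realDifferential g (f x)).comp (realDifferential f x) := by
  have h := mfderiv_comp x hg hf
  ext v
  exact DFunLike.congr_fun h v

theorem realDifferential_congr {f g : M → X} {x : M} (h : f =ᶠ[nhds x] g) :
    realDifferential (E := E) f x = realDifferential g x := by
  rw [realDifferential, realDifferential, h.mfderiv_eq]

theorem realDifferential_id (x : M) :
    realDifferential (fun y : M => y) x = ContinuousLinearMap.id ℝ E := by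
  have h := mfderiv_id (I := 𝓘(ℂ, E)) (x := x)
  ext v
  exact DFunLike.congr_fun h v

theorem realDifferential_eq_fderiv {f : E → E} {x : E} (hf : DifferentiableAt ℂ f x) :
    realDifferential f x = fderiv ℝ f x := by
  rw [hf.fderiv_restrictScalars ℝ, realDifferential, mfderiv_eq_fderiv]

theorem realDifferential_eq_fderiv_chart {f : M → X} {x : M}
    (hf : MDifferentiableAt 𝓘(ℂ, E) 𝓘(ℂ, E) f x) :
    realDifferential f x =
      fderiv ℝ (fun y => chartAt E (f x) (f ((chartAt E x).symm y))) (chartAt E x x) := by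
  have h2 : DifferentiableAt ℂ (fun y => chartAt E (f x) (f ((chartAt E x).symm y)))
      (chartAt E x x) := by
    have := hf.differentiableWithinAt_writtenInExtChartAt
    simpa [writtenInExtChartAt, Function.comp_def, differentiableWithinAt_univ] using this
  rw [h2.fderiv_restrictScalars ℝ, realDifferential, hf.mfderiv]
  simp [writtenInExtChartAt, Function.comp_def]

/-- The operators `∂` and `∂̄` and their linear combinations, on a complex manifold. -/
def twistForm (a b : ℂ) {p : ℕ} (α : DForm E X p) : DForm E X (p + 1) := fun x =>
  twist E a b p (fderiv ℝ (inChart α x) (chartAt E x x))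

theorem del_eq_twistForm {p : ℕ} (α : DForm E X p) :
    del α = twistForm (1 / 2) (-(Complex.I / 2)) α :=
  funext fun _ => flatDel_eq_twist _ _

theorem delbar_eq_twistForm {p : ℕ} (α : DForm E X p) :
    delbar α = twistForm (1 / 2) (Complex.I / 2) α :=
  funext fun _ => flatDelbar_eq_twist _ _

theorem mdifferentiableAt_chart [IsManifold 𝓘(ℂ, E) ω X] {x₀ x : X}
    (hx : x ∈ (chartAt E x₀).source) :
    MDifferentiableAt 𝓘(ℂ, E) 𝓘(ℂ, E) (chartAt E x₀) x :=
  ((contMDiffOn_chart (I := 𝓘(ℂ, E)) (n := ω)).contMDiffAt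
    ((chartAt E x₀).open_source.mem_nhds hx)).mdifferentiableAt (by simp)

theorem mdifferentiableAt_chart_symm [IsManifold 𝓘(ℂ, E) ω X] {x₀ : X} {y : E}
    (hy : y ∈ (chartAt E x₀).target) :
    MDifferentiableAt 𝓘(ℂ, E) 𝓘(ℂ, E) (chartAt E x₀).symm y :=
  ((contMDiffOn_chart_symm (I := 𝓘(ℂ, E)) (n := ω)).contMDiffAt
    ((chartAt E x₀).open_target.mem_nhds hy)).mdifferentiableAt (by simp)

theorem inChart_vectorSpace {p : ℕ} (α : DForm E E p) (x : E) : inChart α x = α := by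
  funext y
  have h : realDifferential (chartAt E x).symm y = ContinuousLinearMap.id ℝ E :=
    realDifferential_id (M := E) y
  rw [inChart, pullback, h]
  rfl

section Local

variable {h : M → X} {V : Set M}

/-- The domain of the coordinate expression of a map defined on `V`. -/
def coordDomain (h : M → X) (V : Set M) (m : M) (x : X) : Set E :=
  (chartAt E m).target ∩ (chartAt E m).symm ⁻¹' (V ∩ h ⁻¹' (chartAt E x).source)

theorem isOpen_coordDomain (hV : IsOpen V) (hh : ContMDiffOn 𝓘(ℂ, E) 𝓘(ℂ, E) ω h V)
    (m : M) (x : X) : IsOpen (coordDomain (E := E) h V m x) :=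
  (chartAt E m).isOpen_inter_preimage_symm
    (hh.continuousOn.isOpen_inter_preimage hV (chartAt E x).open_source)

variable [IsManifold 𝓘(ℂ, E) ω X] [IsManifold 𝓘(ℂ, E) ω M]

theorem contDiffOn_coordDomain (hh : ContMDiffOn 𝓘(ℂ, E) 𝓘(ℂ, E) ω h V) (m : M) (x : X) :
    ContDiffOn ℂ ω (fun y => chartAt E x (h ((chartAt E m).symm y)))
      (coordDomain (E := E) h V m x) := by
  rw [← contMDiffOn_iff_contDiffOn]
  exact (contMDiffOn_chart (I := 𝓘(ℂ, E)) (x := x)).comp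
    (hh.comp ((contMDiffOn_chart_symm (I := 𝓘(ℂ, E)) (x := m)).mono fun y hy => hy.1)
      fun y hy => hy.2.1) fun y hy => hy.2.2

/-- Near `y`, `h` after the inverse chart at `m` agrees with the inverse chart at `x` after the
coordinate expression of `h`. The chain rule applied to both factorizations gives the formula. -/
theorem inChart_pullback {p : ℕ} (hV : IsOpen V) (hh : ContMDiffOn 𝓘(ℂ, E) 𝓘(ℂ, E) ω h V)
    (α : DForm E X p) (m : M) (x : X) {y : E} (hy : y ∈ coordDomain (E := E) h V m x) :
    inChart (pullback h α) m y =
      (inChart α x (chartAt E x (h ((chartAt E m).symm y)))).compContinuousLinearMap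
        (fderiv ℝ (fun y => chartAt E x (h ((chartAt E m).symm y))) y) := by
  have hD := (contDiffOn_coordDomain hh m x).contDiffAt
    ((isOpen_coordDomain hV hh m x).mem_nhds hy)
  have hH := hD.differentiableAt (by simp)
  have hhm : MDifferentiableAt 𝓘(ℂ, E) 𝓘(ℂ, E) h ((chartAt E m).symm y) :=
    (hh.contMDiffAt (hV.mem_nhds hy.2.1)).mdifferentiableAt (by simp)
  have h1 := realDifferential_comp hhm (mdifferentiableAt_chart_symm hy.1)
  have h2 := realDifferential_comp
    (f := fun y => chartAt E x (h ((chartAt E m).symm y)))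
    (mdifferentiableAt_chart_symm ((chartAt E x).map_source hy.2.2)) hH.mdifferentiableAt
  have h3 : (fun y => (chartAt E x).symm (chartAt E x (h ((chartAt E m).symm y)))) =ᶠ[nhds y]
      fun y => h ((chartAt E m).symm y) := by
    filter_upwards [(isOpen_coordDomain hV hh m x).mem_nhds hy] with z hz
    exact (chartAt E x).left_inv hz.2.2
  rw [realDifferential_congr h3, h1, realDifferential_eq_fderiv hH] at h2
  ext v
  have h4 := DFunLike.congr_fun h2
  simp only [ContinuousLinearMap.comp_apply] at h4
  simp only [inChart, pullback, ContinuousAlternatingMap.compContinuousLinearMap_apply,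
    Function.comp_def, h4, (chartAt E x).left_inv hy.2.2]

/-- `∂` and `∂̄` commute with the pullback by holomorphic maps. -/
theorem twistForm_pullback {p : ℕ} (a b : ℂ) (hV : IsOpen V)
    (hh : ContMDiffOn 𝓘(ℂ, E) 𝓘(ℂ, E) ω h V) {α : DForm E X p} {m : M} (hm : m ∈ V)
    (hα : IsSmooth α) :
    twistForm a b (pullback h α) m = pullback h (twistForm a b α) m := by
  have hmem : chartAt E m m ∈ coordDomain (E := E) h V m (h m) := by
    refine ⟨mem_chart_target E m, ?_⟩
    simp [hm]
  have hD : DifferentiableAt ℝ (inChart α (h m)) (chartAt E (h m) (h m)) :=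
    ((hα (h m)).contDiffAt ((chartAt E (h m)).open_target.mem_nhds
      (mem_chart_target E (h m)))).differentiableAt (by simp)
  have heq : inChart (pullback h α) m =ᶠ[nhds (chartAt E m m)] fun y =>
      (inChart α (h m) (chartAt E (h m) (h ((chartAt E m).symm y)))).compContinuousLinearMap
        (fderiv ℝ (fun y => chartAt E (h m) (h ((chartAt E m).symm y))) y) := by
    filter_upwards [(isOpen_coordDomain hV hh m (h m)).mem_nhds hmem] with y hy
    exact inChart_pullback hV hh α m (h m) hy
  have hx : (chartAt E m).symm (chartAt E m m) = m := (chartAt E m).left_inv (mem_chart_source E m)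
  rw [twistForm, heq.fderiv_eq]
  have hnat := twist_fderiv_pullback a b (α := inChart α (h m))
    (isOpen_coordDomain hV hh m (h m)) (contDiffOn_coordDomain hh m (h m)) hmem
    (by simpa only [hx] using hD)
  rw [hnat, pullback, realDifferential_eq_fderiv_chart
    ((hh.contMDiffAt (hV.mem_nhds hm)).mdifferentiableAt (by simp)), twistForm]
  simp only [hx]

end Local

/-- `twistForm` uses a different preferred chart at every point, whereas here one chart serves a
whole open set. Naturality under the holomorphic inverse chart bridges the two, the charts of `E`
itself being the identity. -/
theorem inChart_twistForm [IsManifold 𝓘(ℂ, E) ω X] {p : ℕ} (a b : ℂ) {α : DForm E X p}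
    (hα : IsSmooth α) (x₀ : X) {y : E} (hy : y ∈ (chartAt E x₀).target) :
    inChart (twistForm a b α) x₀ y = twist E a b p (fderiv ℝ (inChart α x₀) y) := by
  have h := twistForm_pullback a b (chartAt E x₀).open_target
    (contMDiffOn_chart_symm (I := 𝓘(ℂ, E)) (n := ω)) hy hα
  rw [inChart, ← h, twistForm, inChart_vectorSpace]
  rfl

theorem IsSmooth.twistForm [IsManifold 𝓘(ℂ, E) ω X] {p : ℕ} (a b : ℂ) {α : DForm E X p}
    (hα : IsSmooth α) : IsSmooth (twistForm a b α) := fun x₀ =>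
  (contDiffOn_twist a b (chartAt E x₀).open_target (hα x₀)).congr fun _ hy =>
    inChart_twistForm a b hα x₀ hy

theorem IsSmooth.delbar [IsManifold 𝓘(ℂ, E) ω X] {p : ℕ} {α : DForm E X p}
    (hα : IsSmooth α) : IsSmooth (delbar α) := by
  rw [delbar_eq_twistForm]
  exact hα.twistForm _ _

theorem wedge_comp {p q : ℕ} (a : E [⋀^Fin p]→L[ℝ] ℂ) (b : E [⋀^Fin q]→L[ℝ] ℂ) (L : E →L[ℝ] E) :
    (wedge a b).compContinuousLinearMap L =
      wedge (a.compContinuousLinearMap L) (b.compContinuousLinearMap L) := by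
  ext v
  simp only [ContinuousAlternatingMap.compContinuousLinearMap_apply, wedge_apply,
    Function.comp_def]

theorem wedgePow_comp (a : E [⋀^Fin 2]→L[ℝ] ℂ) (L : E →L[ℝ] E) (k : ℕ) :
    (wedgePow a k).compContinuousLinearMap L = wedgePow (a.compContinuousLinearMap L) k := by
  induction k with
  | zero => rfl
  | succ k ih => exact (wedge_comp _ _ _).trans (by rw [ih]; rfl)

theorem HermitianMetric.isSmooth_pow (F : HermitianMetric E X) (k : ℕ) : IsSmooth (F.pow k) :=
  fun x₀ => (contDiffOn_wedgePow (F.smooth x₀) k).congr fun _ _ => wedgePow_comp _ _ _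

theorem del_delbar_pullback [IsManifold 𝓘(ℂ, E) ω X] [IsManifold 𝓘(ℂ, E) ω M] {h : M → X}
    (hh : ContMDiff 𝓘(ℂ, E) 𝓘(ℂ, E) ω h) {p : ℕ} {α : DForm E X p} (hα : IsSmooth α) :
    del (delbar (pullback h α)) = pullback h (del (delbar α)) := by
  have h1 : delbar (pullback h α) = pullback h (delbar α) := by
    rw [delbar_eq_twistForm, delbar_eq_twistForm]
    exact funext fun m => twistForm_pullback _ _ isOpen_univ hh.contMDiffOn (Set.mem_univ m) hα
  rw [h1, del_eq_twistForm, del_eq_twistForm]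
  exact funext fun m =>
    twistForm_pullback _ _ isOpen_univ hh.contMDiffOn (Set.mem_univ m) hα.delbar

/-- The right side involves `h` only through `pullback h F.form`; this is how invariance of the
metric reaches the Gauduchon forms. -/
theorem HermitianMetric.pullback_gauduchonForm [IsManifold 𝓘(ℂ, E) ω X] [IsManifold 𝓘(ℂ, E) ω M]
    (F : HermitianMetric E X) {h : M → X} (hh : ContMDiff 𝓘(ℂ, E) 𝓘(ℂ, E) ω h) (n k : ℕ) :
    pullback h (F.gauduchonForm n k) = fun m =>
      wedge (Gauduchon.del (Gauduchon.delbar fun m => wedgePow (pullback h F.form m) k) m)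
        (wedgePow (pullback h F.form m) (n - k - 1)) := by
  have h1 : (fun m => wedgePow (pullback h F.form m) k) = pullback h (F.pow k) :=
    funext fun m => (wedgePow_comp _ _ _).symm
  rw [h1, del_delbar_pullback hh (F.isSmooth_pow k)]
  funext m
  rw [pullback, gauduchonForm, wedge_comp, pow, wedgePow_comp]
  rfl

end Naturality

/-! ### Forms of top degree and determinants. -/

section TopForms

variable {E : Type*} [NormedAddCommGroup E] [NormedSpace ℂ E]

theorem top_form_apply {m : ℕ} (B : Module.Basis (Fin m) ℝ E) (η : E [⋀^Fin m]→L[ℝ] ℂ)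
    (v : Fin m → E) : η v = B.det v • η B := by
  have h : η.toAlternatingMap =
      (LinearMap.toSpanSingleton ℝ ℂ (η B)).compAlternatingMap B.det := by
    refine Module.Basis.ext_alternating B fun i hi => ?_
    let σ : Equiv.Perm (Fin m) := Equiv.ofBijective i (Finite.injective_iff_bijective.1 hi)
    change η.toAlternatingMap (B ∘ σ) =
      ((LinearMap.toSpanSingleton ℝ ℂ (η B)).compAlternatingMap B.det) (B ∘ σ)
    rw [AlternatingMap.map_perm, AlternatingMap.map_perm]
    simp [Module.Basis.det_self]
  exact DFunLike.congr_fun h v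

theorem top_form_comp {m : ℕ} (hm : Module.finrank ℝ E = m) [FiniteDimensional ℝ E]
    (η : E [⋀^Fin m]→L[ℝ] ℂ) (L : E →ₗ[ℝ] E) (v : Fin m → E) :
    η (fun i => L (v i)) = LinearMap.det L • η v := by
  let B : Module.Basis (Fin m) ℝ E := Module.finBasisOfFinrankEq ℝ E hm
  rw [top_form_apply B η, top_form_apply B η v, smul_smul]
  congr 1
  exact Module.Basis.det_comp B L v

theorem top_form_mul_comm {m : ℕ} (hm : Module.finrank ℝ E = m) [FiniteDimensional ℝ E]
    (η θ : E [⋀^Fin m]→L[ℝ] ℂ) (v w : Fin m → E) : η v * θ w = η w * θ v := by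
  let B : Module.Basis (Fin m) ℝ E := Module.finBasisOfFinrankEq ℝ E hm
  rw [top_form_apply B η v, top_form_apply B θ w, top_form_apply B η w, top_form_apply B θ v]
  simp only [Complex.real_smul]
  ring

/-- The real determinant of a complex-linear map is the squared modulus of its complex determinant.
-/
theorem det_restrictScalars_pos (A : E ≃L[ℂ] E) [FiniteDimensional ℂ E] :
    0 < LinearMap.det ((A : E →ₗ[ℂ] E).restrictScalars ℝ) := by
  rw [LinearMap.det_restrictScalars, Algebra.norm_complex_apply]
  exact Complex.normSq_pos.2 (LinearEquiv.isUnit_det' A.toLinearEquiv).ne_zero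

end TopForms

/-! ### Positivity of the top power of a positive `(1,1)`-form. -/

section Positive

variable {E : Type*} [NormedAddCommGroup E] [NormedSpace ℂ E]

/-- A positive real `(1,1)`-form. -/
structure IsPositiveForm (φ : E [⋀^Fin 2]→L[ℝ] ℂ) : Prop where
  real : ∀ v, (φ v).im = 0
  map_I_smul : ∀ u v : E, φ ![Complex.I • u, Complex.I • v] = φ ![u, v]
  pos : ∀ v : E, v ≠ 0 → 0 < (φ ![v, Complex.I • v]).re

/-- The tuple `e 0, i e 0, e 1, i e 1, …`. -/
def frame (e : ℕ → E) (i : ℕ) : E := if i % 2 = 0 then e (i / 2) else Complex.I • e (i / 2)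

theorem frame_even (e : ℕ → E) (m : ℕ) : frame e (2 * m) = e m := by
  simp [frame]

theorem frame_odd (e : ℕ → E) (m : ℕ) : frame e (2 * m + 1) = Complex.I • e m := by
  rw [frame, if_neg (by omega), show (2 * m + 1) / 2 = m by omega]

/-- `a` vanishes as soon as one of its arguments is `u`. -/
def Kills {p : ℕ} (a : E [⋀^Fin p]→L[ℝ] ℂ) (u : E) : Prop :=
  ∀ (v : Fin p → E) (i : Fin p), v i = u → a v = 0

theorem Kills.wedge {p q : ℕ} {a : E [⋀^Fin p]→L[ℝ] ℂ} {b : E [⋀^Fin q]→L[ℝ] ℂ} {u : E}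
    (ha : Kills a u) (hb : Kills b u) : Kills (wedge a b) u := by
  intro v i hi
  rw [wedge_apply, Finset.sum_eq_zero, smul_zero]
  intro σ _
  obtain ⟨j, rfl⟩ := σ.surjective i
  induction j using Fin.addCases with
  | left j => rw [ha _ j hi, zero_mul, smul_zero]
  | right j => rw [hb _ j hi, mul_zero, smul_zero]

theorem Kills.wedgePow {a : E [⋀^Fin 2]→L[ℝ] ℂ} {u : E} (ha : Kills a u) (k : ℕ) :
    Kills (wedgePow a k) u := by
  induction k with
  | zero => exact fun v i => i.elim0
  | succ k ih => exact ih.wedge ha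

theorem Kills.add {p : ℕ} {a b : E [⋀^Fin p]→L[ℝ] ℂ} {u : E} (ha : Kills a u) (hb : Kills b u) :
    Kills (a + b) u := fun v i hi => by
  rw [ContinuousAlternatingMap.add_apply, ha v i hi, hb v i hi, add_zero]

theorem kills_zero {p : ℕ} (u : E) : Kills (0 : E [⋀^Fin p]→L[ℝ] ℂ) u := fun _ _ _ => rfl

theorem Kills.sum {p : ℕ} {ι : Type*} {s : Finset ι} {a : ι → E [⋀^Fin p]→L[ℝ] ℂ} {u : E}
    (ha : ∀ i ∈ s, Kills (a i) u) : Kills (∑ i ∈ s, a i) u := by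
  classical
  induction s using Finset.induction_on with
  | empty => exact kills_zero u
  | insert i s hi ih =>
    rw [Finset.sum_insert hi]
    exact (ha i (by simp)).add (ih fun j hj => ha j (by simp [hj]))

/-- Every shuffle other than the identity class feeds `a` one of the last `q` vectors. -/
theorem wedge_apply_of_kills {p q : ℕ} (a : E [⋀^Fin p]→L[ℝ] ℂ) (b : E [⋀^Fin q]→L[ℝ] ℂ)
    (v : Fin (p + q) → E) (ha : ∀ i : Fin q, Kills a (v (Fin.natAdd p i))) :
    wedge a b v = a (fun i => v (Fin.castAdd q i)) * b (fun i => v (Fin.natAdd p i)) := by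
  change LinearMap.mul' ℝ ℂ (a.toAlternatingMap.domCoprod b.toAlternatingMap
    (fun i => v (finSumFinEquiv i))) = _
  rw [AlternatingMap.domCoprod_apply, sum_apply]
  refine (congrArg _ (Finset.sum_eq_single
    (Quotient.mk'' 1 : Equiv.Perm.ModSumCongr (Fin p) (Fin q)) ?_ ?_)).trans ?_
  rotate_left 2
  · rw [AlternatingMap.domCoprod.summand_mk'']
    simp
  · intro σ _ hσ
    induction σ using Quotient.inductionOn' with
    | _ σ =>
      rw [AlternatingMap.domCoprod.summand_mk'']
      have hex : ∃ (i : Fin p) (j : Fin q), σ (Sum.inl i) = Sum.inr j := by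
        by_contra! hno
        apply hσ
        refine Quotient.sound' ?_
        rw [QuotientGroup.leftRel_apply, mul_one, inv_mem_iff]
        refine Equiv.Perm.mem_sumCongrHom_range_of_perm_mapsTo_inl ?_
        rintro _ ⟨i, rfl⟩
        rcases h : σ (Sum.inl i) with j | j
        · exact ⟨j, rfl⟩
        · exact (hno i j h).elim
      obtain ⟨i, j, hij⟩ := hex
      have h0 : a (fun i => v (finSumFinEquiv (σ (Sum.inl i)))) = 0 := by
        refine ha j _ i ?_
        rw [hij, finSumFinEquiv_apply_right]
      rcases Int.units_eq_one_or (Equiv.Perm.sign σ) with hs | hs <;>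
        simp [hs, h0]
  · intro h
    exact (h (Finset.mem_univ _)).elim

theorem add_pow_of_sq_eq_zero {R : Type*} [Ring R] {x y : R} (hxy : Commute x y)
    (hy : y * y = 0) (m : ℕ) : (x + y) ^ (m + 1) = x ^ (m + 1) + (m + 1) • (x ^ m * y) := by
  induction m with
  | zero => simp
  | succ m ih =>
    rw [pow_succ, ih, add_mul, mul_add, mul_add, smul_mul_assoc, smul_mul_assoc, mul_assoc _ y y,
      hy, mul_zero, smul_zero, add_zero, mul_assoc _ y x, ← hxy.eq, ← mul_assoc, ← pow_succ,
      ← pow_succ, add_smul (m + 1) 1, one_smul, add_assoc, add_comm (_ • _)]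

/-- With `S` the sum of the first `m` forms, `(S + θ m) ^ (m + 1)` is `S ^ (m + 1) + (m + 1) S ^ m ∧
θ m` because `θ m` squares to zero. The first term dies because `S` kills `e m`; the second splits
and gives the induction. -/
theorem wedgePow_sum_apply_frame (θ : ℕ → E [⋀^Fin 2]→L[ℝ] ℂ) (e : ℕ → E) {n : ℕ}
    (hk : ∀ j < n, ∀ k < n, j ≠ k → Kills (θ j) (e k) ∧ Kills (θ j) (Complex.I • e k))
    (hsq : ∀ j < n, wedge (θ j) (θ j) = 0) (hone : ∀ j < n, θ j ![e j, Complex.I • e j] = 1)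
    (m : ℕ) (hm : m ≤ n) :
    wedgePow (∑ j ∈ Finset.range m, θ j) m (fun i => frame e i) = m.factorial := by
  induction m with
  | zero => simp [wedgePow]
  | succ m ih =>
    set S := ∑ j ∈ Finset.range m, θ j with hS
    have hSk : Kills S (e m) ∧ Kills S (Complex.I • e m) := by
      constructor <;> refine Kills.sum fun j hj => ?_ <;>
        have hj' := Finset.mem_range.1 hj
      · exact (hk j (by omega) m (by omega) (by omega)).1
      · exact (hk j (by omega) m (by omega) (by omega)).2
    have hexp : wedgePow (∑ j ∈ Finset.range (m + 1), θ j) (m + 1) =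
        wedgePow S (m + 1) + (m + 1) • wedge (wedgePow S m) (θ m) := by
      apply toRing_injective
      have h2 : toRing (θ m) * toRing (θ m) = 0 := by
        rw [← toRing_wedge, hsq m (by omega), toRing_zero]
      have h3 := toRing_add (wedgePow S (m + 1)) ((m + 1) • wedge (wedgePow S m) (θ m))
      refine Eq.trans ?_ h3.symm
      rw [toRing_nsmul, toRing_wedge, toRing_wedgePow, toRing_wedgePow, toRing_wedgePow,
        Finset.sum_range_succ, toRing_add, add_pow_of_sq_eq_zero (commute_toRing _ _) h2]
    have h1 : wedgePow S (m + 1) (fun i => frame e i) = 0 := by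
      refine hSk.1.wedgePow (m + 1) _ ⟨2 * m, by omega⟩ ?_
      exact frame_even e m
    have h2 : wedge (wedgePow S m) (θ m) (fun i => frame e i) = m.factorial := by
      rw [wedge_apply_of_kills]
      · have h4 : (fun i : Fin 2 => frame e (Fin.natAdd (2 * m) i)) = ![e m, Complex.I • e m] := by
          funext i
          fin_cases i
          · exact frame_even e m
          · exact frame_odd e m
        rw [h4, hone m (by omega), mul_one]
        exact ih (by omega)
      · intro i
        fin_cases i
        · exact (frame_even e m).symm ▸ hSk.1.wedgePow m
        · exact (frame_odd e m).symm ▸ hSk.2.wedgePow m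
    rw [hexp]
    have h5 : (wedgePow S (m + 1) + (m + 1) • wedge (wedgePow S m) (θ m)) (fun i => frame e i) =
      wedgePow S (m + 1) (fun i => frame e i) +
        (m + 1) • wedge (wedgePow S m) (θ m) (fun i => frame e i) := rfl
    rw [h5, h1, h2, Nat.factorial_succ]
    simp

end Positive

/-- `V` is a bare vector space here, so the norm coming from `c` cannot clash with the norm that `E`
already carries. -/
theorem exists_orthonormal_basis_of_core {V : Type*} [AddCommGroup V] [Module ℂ V]
    [FiniteDimensional ℂ V] (c : InnerProductSpace.Core ℂ V) :
    ∃ b : Module.Basis (Fin (Module.finrank ℂ V)) ℂ V,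
      ∀ i j, c.inner (b i) (b j) = if i = j then 1 else 0 := by
  let _ : NormedAddCommGroup V := c.toNormedAddCommGroup
  let _ : InnerProductSpace ℂ V := InnerProductSpace.ofCore c.toCore
  refine ⟨(stdOrthonormalBasis ℂ V).toBasis, fun i j => ?_⟩
  have h := orthonormal_iff_ite.1 (stdOrthonormalBasis ℂ V).orthonormal i j
  simpa using h

section Positive

variable {E : Type*} [NormedAddCommGroup E] [NormedSpace ℂ E] {φ : E [⋀^Fin 2]→L[ℝ] ℂ}

theorem two_form_add_left (φ : E [⋀^Fin 2]→L[ℝ] ℂ) (u u' v : E) :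
    φ ![u + u', v] = φ ![u, v] + φ ![u', v] := by
  have h := φ.map_update_add ![u, v] 0 u u'
  have h1 (x : E) : Function.update ![u, v] 0 x = ![x, v] := by
    funext i
    fin_cases i <;> rfl
  rwa [h1, h1, h1] at h

theorem two_form_smul_left (φ : E [⋀^Fin 2]→L[ℝ] ℂ) (c : ℝ) (u v : E) :
    φ ![c • u, v] = c * φ ![u, v] := by
  have h := φ.map_update_smul ![u, v] 0 c u
  have h1 (x : E) : Function.update ![u, v] 0 x = ![x, v] := by
    funext i
    fin_cases i <;> rfl
  rwa [h1, h1, Complex.real_smul] at h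

theorem two_form_swap (φ : E [⋀^Fin 2]→L[ℝ] ℂ) (u v : E) : φ ![v, u] = -φ ![u, v] := by
  have h : φ (![u, v] ∘ Equiv.swap 0 1) = -φ ![u, v] :=
    φ.toAlternatingMap.map_swap ![u, v] (show (0 : Fin 2) ≠ 1 by decide)
  rw [← h]
  congr 1
  funext i
  fin_cases i <;> simp

theorem two_form_self (φ : E [⋀^Fin 2]→L[ℝ] ℂ) (u : E) : φ ![u, u] = 0 :=
  self_eq_neg.1 (two_form_swap φ u u)

theorem two_form_add_right (φ : E [⋀^Fin 2]→L[ℝ] ℂ) (u v v' : E) :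
    φ ![u, v + v'] = φ ![u, v] + φ ![u, v'] := by
  rw [two_form_swap φ _ u, two_form_add_left, two_form_swap φ u v, two_form_swap φ u v']
  ring

theorem two_form_smul_right (φ : E [⋀^Fin 2]→L[ℝ] ℂ) (c : ℝ) (u v : E) :
    φ ![u, c • v] = c * φ ![u, v] := by
  rw [two_form_swap φ _ u, two_form_smul_left, two_form_swap φ u v]
  ring

theorem two_form_neg_right (φ : E [⋀^Fin 2]→L[ℝ] ℂ) (u v : E) :
    φ ![u, -v] = -φ ![u, v] := by
  simpa using two_form_smul_right φ (-1) u v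

/-- A form of degree two as a bilinear map. -/
def twoFormBilin (φ : E [⋀^Fin 2]→L[ℝ] ℂ) : E →ₗ[ℝ] E →ₗ[ℝ] ℂ :=
  LinearMap.mk₂ ℝ (fun u v => φ ![u, v]) (two_form_add_left φ)
    (fun c u v => (two_form_smul_left φ c u v).trans (Complex.real_smul ..).symm)
    (two_form_add_right φ)
    (fun c u v => (two_form_smul_right φ c u v).trans (Complex.real_smul ..).symm)

namespace IsPositiveForm

theorem map_I_smul_left (hφ : IsPositiveForm φ) (u v : E) :
    φ ![Complex.I • u, v] = -φ ![u, Complex.I • v] := by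
  have h := hφ.map_I_smul u (Complex.I • v)
  rw [smul_smul, Complex.I_mul_I, neg_one_smul, two_form_neg_right] at h
  rw [← h, neg_neg]

theorem map_smul_left (hφ : IsPositiveForm φ) (r : ℂ) (u v : E) :
    φ ![r • u, v] = r.re * φ ![u, v] - r.im * φ ![u, Complex.I • v] := by
  have h : r • u = r.re • u + r.im • (Complex.I • u) := by
    conv_lhs => rw [← Complex.re_add_im r, add_smul, mul_smul]
    simp
  rw [h, two_form_add_left, two_form_smul_left, two_form_smul_left, hφ.map_I_smul_left]
  ring

/-- The Hermitian inner product with imaginary part `φ`. -/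
@[reducible]
def core (hφ : IsPositiveForm φ) : InnerProductSpace.Core ℂ E where
  inner u v := φ ![u, Complex.I • v] + Complex.I * φ ![u, v]
  conj_inner_symm u v := by
    have h (w : Fin 2 → E) : (starRingEnd ℂ) (φ w) = φ w := Complex.conj_eq_iff_im.2 (hφ.real w)
    rw [map_add, map_mul, h, h, Complex.conj_I, two_form_swap φ (Complex.I • u) v,
      hφ.map_I_smul_left, two_form_swap φ u v]
    ring
  re_inner_nonneg u := by
    rw [two_form_self, mul_zero, add_zero]
    rcases eq_or_ne u 0 with rfl | hu
    · rw [smul_zero, two_form_self]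
      exact le_rfl
    · exact (hφ.pos u hu).le
  add_left u v w := by
    rw [two_form_add_left, two_form_add_left]
    ring
  smul_left u v r := by
    have hr : (starRingEnd ℂ) r = r.re - r.im * Complex.I := by
      apply Complex.ext <;> simp
    rw [hφ.map_smul_left, hφ.map_smul_left, smul_smul, Complex.I_mul_I, neg_one_smul,
      two_form_neg_right, hr]
    linear_combination (r.im * φ ![u, v]) * Complex.I_mul_I
  definite u hu := by
    by_contra hne
    rw [two_form_self, mul_zero, add_zero] at hu
    have := hφ.pos u hne
    rw [hu] at this
    simp at this

theorem inner_def (hφ : IsPositiveForm φ) (u v : E) :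
    hφ.core.inner u v = φ ![u, Complex.I • v] + Complex.I * φ ![u, v] := rfl

theorem eq_zero_of_inner_eq_zero (hφ : IsPositiveForm φ) {u v : E} (h : hφ.core.inner u v = 0)
    (r s : ℂ) : φ ![r • u, s • v] = 0 := by
  have h1 : hφ.core.inner (r • u) (s • v) = 0 := by
    rw [hφ.core.smul_left, ← hφ.core.conj_inner_symm, hφ.core.smul_left,
      ← hφ.core.conj_inner_symm v u, h]
    simp
  rw [inner_def] at h1
  have h2 := congrArg Complex.im h1
  simp [hφ.real] at h2
  exact Complex.ext h2 (hφ.real _)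

end IsPositiveForm

theorem finrank_real_eq {n : ℕ} (hdim : Module.finrank ℂ E = n) : Module.finrank ℝ E = 2 * n := by
  rw [finrank_real_of_complex, hdim]

variable {n : ℕ} (b : Module.Basis (Fin n) ℂ E)

/-- The vectors of a basis, indexed by natural numbers. -/
def basisSeq (k : ℕ) : E := if h : k < n then b ⟨k, h⟩ else 0

theorem basisSeq_of_lt {k : ℕ} (h : k < n) : basisSeq b k = b ⟨k, h⟩ := dif_pos h

theorem kills_comp {p : ℕ} (a : E [⋀^Fin p]→L[ℝ] ℂ) (L : E →L[ℝ] E) {u : E} (hu : L u = 0) :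
    Kills (a.compContinuousLinearMap L) u := fun v i hi => by
  rw [ContinuousAlternatingMap.compContinuousLinearMap_apply]
  exact a.map_coord_zero i (by simp [hi, hu])

variable [FiniteDimensional ℂ E]

/-- The real-linear projection to the line spanned by a basis vector. -/
def coordProj (j : ℕ) : E →L[ℝ] E :=
  if h : j < n then
    (LinearMap.toContinuousLinearMap ((b.coord ⟨j, h⟩).smulRight (b ⟨j, h⟩))).restrictScalars ℝ
  else 0

theorem coordProj_apply {j : ℕ} (h : j < n) (v : E) :
    coordProj b j v = b.repr v ⟨j, h⟩ • b ⟨j, h⟩ := by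
  rw [coordProj, dif_pos h]
  rfl

theorem coordProj_smul_basisSeq_of_ne (c : ℂ) {j k : ℕ} (hj : j < n) (hk : k < n) (hjk : j ≠ k) :
    coordProj b j (c • basisSeq b k) = 0 := by
  rw [coordProj_apply b hj, basisSeq_of_lt b hk]
  simp [Ne.symm hjk]

theorem coordProj_smul_basisSeq_self (c : ℂ) {j : ℕ} (hj : j < n) :
    coordProj b j (c • basisSeq b j) = c • basisSeq b j := by
  rw [coordProj_apply b hj, basisSeq_of_lt b hj]
  simp

/-- The projection has image in a complex line, where four vectors are linearly dependent over `ℝ`.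
It makes the square of each coordinate piece of a two-form vanish. -/
theorem comp_coordProj_eq_zero (η : E [⋀^Fin 4]→L[ℝ] ℂ) {j : ℕ} (hj : j < n) :
    η.compContinuousLinearMap (coordProj b j) = 0 := by
  ext v
  rw [ContinuousAlternatingMap.compContinuousLinearMap_apply]
  refine η.toAlternatingMap.map_linearDependent _ fun hli => ?_
  let L : ℂ →ₗ[ℝ] E := (LinearMap.toSpanSingleton ℂ E (b ⟨j, hj⟩)).restrictScalars ℝ
  have h1 : (coordProj b j : E → E) ∘ v = L ∘ fun i => b.repr (v i) ⟨j, hj⟩ := by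
    funext i
    exact coordProj_apply b hj (v i)
  have h2 : LinearIndependent ℝ fun i => b.repr (v i) ⟨j, hj⟩ := by
    refine LinearIndependent.of_comp L ?_
    rw [← h1]
    exact hli
  have h3 := h2.fintype_card_le_finrank
  rw [Complex.finrank_real_complex, Fintype.card_fin] at h3
  omega

/-- In an orthonormal basis the cross terms vanish, and `φ` is the sum of its pieces along the
coordinate lines, to which `wedgePow_sum_apply_frame` applies. -/
theorem IsPositiveForm.wedgePow_frame (hφ : IsPositiveForm φ)
    (hb : ∀ i j, hφ.core.inner (b i) (b j) = if i = j then 1 else 0) :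
    wedgePow φ n (fun i => frame (basisSeq b) i) = n.factorial := by
  have hsum : φ = ∑ j ∈ Finset.range n, φ.compContinuousLinearMap (coordProj b j) := by
    ext v
    have hv (w : Fin 2 → E) : φ w = twoFormBilin φ (w 0) (w 1) := by
      change φ w = φ ![w 0, w 1]
      congr 1
      funext i
      fin_cases i <;> rfl
    have hrepr (u : E) : u = ∑ j : Fin n, b.repr u j • b j := (b.sum_repr u).symm
    rw [ContinuousAlternatingMap.sum_apply, Finset.sum_range, hv, hrepr (v 0), hrepr (v 1), map_sum]
    refine Finset.sum_congr rfl fun i _ => ?_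
    rw [map_sum, LinearMap.sum_apply, Finset.sum_eq_single i]
    · rw [ContinuousAlternatingMap.compContinuousLinearMap_apply, hv]
      simp only [Function.comp_apply, coordProj_apply b i.2]
    · intro j _ hji
      refine hφ.eq_zero_of_inner_eq_zero ?_ _ _
      rw [hb, if_neg hji]
    · simp
  have key := wedgePow_sum_apply_frame (fun j => φ.compContinuousLinearMap (coordProj b j))
    (basisSeq b) (n := n) ?_ ?_ ?_ n le_rfl
  · rwa [← hsum] at key
  · intro j hj k hk hjk
    refine ⟨kills_comp _ _ ?_, kills_comp _ _ (coordProj_smul_basisSeq_of_ne b _ hj hk hjk)⟩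
    simpa using coordProj_smul_basisSeq_of_ne b 1 hj hk hjk
  · intro j hj
    rw [← wedge_comp]
    exact comp_coordProj_eq_zero b _ hj
  · intro j hj
    have h1 := hb ⟨j, hj⟩ ⟨j, hj⟩
    rw [if_pos rfl, IsPositiveForm.inner_def, two_form_self, mul_zero, add_zero] at h1
    rw [ContinuousAlternatingMap.compContinuousLinearMap_apply]
    have h2 : (coordProj b j : E → E) ∘ ![basisSeq b j, Complex.I • basisSeq b j] =
        ![b ⟨j, hj⟩, Complex.I • b ⟨j, hj⟩] := by
      have h3 := coordProj_smul_basisSeq_self b 1 hj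
      have h4 := coordProj_smul_basisSeq_self b Complex.I hj
      rw [one_smul] at h3
      funext i
      fin_cases i
      · exact h3.trans (basisSeq_of_lt b hj)
      · exact h4.trans (by rw [basisSeq_of_lt b hj]; rfl)
    rw [h2, h1]

/-- There is a tuple on which the top powers of all positive forms are positive. -/
theorem exists_tuple_wedgePow_pos (hdim : Module.finrank ℂ E = n) :
    ∃ w : Fin (2 * n) → E, ∀ φ : E [⋀^Fin 2]→L[ℝ] ℂ, IsPositiveForm φ →
      ∃ t : ℝ, 0 < t ∧ wedgePow φ n w = t := by
  subst hdim
  have : FiniteDimensional ℝ E := FiniteDimensional.complexToReal E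
  let b₀ : Module.Basis (Fin (Module.finrank ℂ E)) ℂ E := Module.finBasis ℂ E
  -- The tuple comes from a basis chosen before `φ`. Passing to it from a `φ`-orthonormal basis is
  -- complex linear and costs only a positive determinant.
  refine ⟨fun i => frame (basisSeq b₀) i, fun φ hφ => ?_⟩
  obtain ⟨b, hb⟩ := exists_orthonormal_basis_of_core hφ.core
  let A : E ≃L[ℂ] E := (b.equiv b₀ (Equiv.refl _)).toContinuousLinearEquiv
  have hA (k : ℕ) : A (basisSeq b k) = basisSeq b₀ k := by
    by_cases hk : k < Module.finrank ℂ E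
    · rw [basisSeq_of_lt b hk, basisSeq_of_lt b₀ hk]
      simp [A]
    · rw [basisSeq, basisSeq, dif_neg hk, dif_neg hk, map_zero]
  have hframe (i : ℕ) : frame (basisSeq b₀) i =
      (A : E →ₗ[ℂ] E).restrictScalars ℝ (frame (basisSeq b) i) := by
    simp only [frame]
    split_ifs
    · exact (hA _).symm
    · exact (by rw [← hA]; exact (map_smul A _ _).symm)
  refine ⟨LinearMap.det ((A : E →ₗ[ℂ] E).restrictScalars ℝ) * (Module.finrank ℂ E).factorial,
    mul_pos (det_restrictScalars_pos A) (by positivity), ?_⟩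
  simp only [hframe]
  rw [top_form_comp (finrank_real_eq rfl), hφ.wedgePow_frame b hb]
  simp

end Positive

/-! ### Reality of `i∂∂̄`. -/

section Real

variable {E : Type*} [NormedAddCommGroup E] [NormedSpace ℂ E]

/-- The form takes real values. -/
def IsRealForm {p : ℕ} (a : E [⋀^Fin p]→L[ℝ] ℂ) : Prop := ∀ v, (a v).im = 0

theorem IsRealForm.wedge {p q : ℕ} {a : E [⋀^Fin p]→L[ℝ] ℂ} {b : E [⋀^Fin q]→L[ℝ] ℂ}
    (ha : IsRealForm a) (hb : IsRealForm b) : IsRealForm (wedge a b) := by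
  intro v
  rw [wedge_apply, Complex.smul_im, Complex.im_sum, Finset.sum_eq_zero, smul_zero]
  intro σ _
  simp [ha _, hb _]

theorem IsRealForm.wedgePow {a : E [⋀^Fin 2]→L[ℝ] ℂ} (ha : IsRealForm a) (k : ℕ) :
    IsRealForm (wedgePow a k) := by
  induction k with
  | zero => exact fun v => Complex.one_im
  | succ k ih => exact ih.wedge ha

theorem isRealForm_alternatizeUncurryFin {p : ℕ} {D : E →L[ℝ] E [⋀^Fin p]→L[ℝ] ℂ}
    (hD : ∀ v, IsRealForm (D v)) :
    IsRealForm (ContinuousAlternatingMap.alternatizeUncurryFin D) := by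
  intro v
  rw [ContinuousAlternatingMap.alternatizeUncurryFin_apply, Complex.im_sum, Finset.sum_eq_zero]
  intro i _
  rcases neg_one_pow_eq_or ℤ (i : ℕ) with h | h <;> simp [h, hD _ _]

theorem isRealForm_fderiv {p : ℕ} {α : E → E [⋀^Fin p]→L[ℝ] ℂ} {x : E}
    (hα : DifferentiableAt ℝ α x) (hr : ∀ᶠ y in nhds x, IsRealForm (α y)) (v : E) :
    IsRealForm (fderiv ℝ α x v) := by
  intro w
  rw [← fderiv_continuousAlternatingMap_apply_const_apply hα]
  have h1 : DifferentiableAt ℝ (fun y => α y w) x := hα.continuousAlternatingMap_apply_const w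
  have h2 := Complex.imCLM.hasFDerivAt.comp x h1.hasFDerivAt
  have h3 : (Complex.imCLM ∘ fun y => α y w) =ᶠ[nhds x] fun _ => (0 : ℝ) :=
    hr.mono fun y hy => hy w
  have h4 := h2.fderiv
  rw [h3.fderiv_eq, fderiv_fun_const] at h4
  exact (DFunLike.congr_fun h4 v).symm

theorem isRealForm_twist {p : ℕ} {D : E →L[ℝ] E [⋀^Fin p]→L[ℝ] ℂ}
    (hD : ∀ v, IsRealForm (D v)) {a b : ℂ} (ha : a.im = 0) (hb : b.im = 0) :
    IsRealForm (twist E a b p D) := by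
  refine isRealForm_alternatizeUncurryFin fun v w => ?_
  simp [ha, hb, hD _ _]

theorem twist_eq_add {p : ℕ} (a b : ℂ) (D : E →L[ℝ] E [⋀^Fin p]→L[ℝ] ℂ) :
    twist E a b p D = a • twist E 1 0 p D + b • twist E 0 1 p D := by
  ext v
  simp [twist_apply, ContinuousAlternatingMap.alternatizeUncurryFin_apply, Finset.mul_sum]

theorem twist_one_zero {p : ℕ} (D : E →L[ℝ] E [⋀^Fin p]→L[ℝ] ℂ) :
    twist E 1 0 p D = ContinuousAlternatingMap.alternatizeUncurryFin D := by
  rw [twist_apply]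
  congr 1
  ext v w
  simp

theorem twist_zero_one {p : ℕ} (D : E →L[ℝ] E [⋀^Fin p]→L[ℝ] ℂ) :
    twist E 0 1 p D = ContinuousAlternatingMap.alternatizeUncurryFin (D.comp (mulI E)) := by
  rw [twist_apply]
  congr 1
  ext v w
  simp

theorem twist_csmul {p : ℕ} (a b c : ℂ) (D : E →L[ℝ] E [⋀^Fin p]→L[ℝ] ℂ) :
    twist E a b p (c • D) = c • twist E a b p D := by
  ext v
  simp [twist_apply, ContinuousAlternatingMap.alternatizeUncurryFin_apply, Finset.mul_sum,
    mul_left_comm]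

variable {p : ℕ} {α : E → E [⋀^Fin p]→L[ℝ] ℂ} {U : Set E} {x : E}

theorem minSmoothness_two_le_infty : minSmoothness ℝ 2 ≤ (∞ : WithTop ℕ∞) := by
  rw [minSmoothness_of_isRCLikeNormedField]
  exact WithTop.coe_le_coe.2 (le_top (a := (2 : ℕ∞)))

theorem twist_one_zero_twist_one_zero (hU : IsOpen U) (hα : ContDiffOn ℝ ∞ α U) (hx : x ∈ U) :
    twist E 1 0 _ (fderiv ℝ (fun y => twist E 1 0 p (fderiv ℝ α y)) x) = 0 := by
  simp only [twist_one_zero]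
  exact extDeriv_extDeriv_apply (hα.contDiffAt (hU.mem_nhds hx))
    (minSmoothness_two_le_infty)

/-- This operator is `d` conjugated by multiplication by `i`, so its square is a conjugate of `d ^
2`. -/
theorem twist_zero_one_twist_zero_one (hU : IsOpen U) (hα : ContDiffOn ℝ ∞ α U) (hx : x ∈ U) :
    twist E 0 1 _ (fderiv ℝ (fun y => twist E 0 1 p (fderiv ℝ α y)) x) = 0 := by
  have hd : DifferentiableAt ℝ (fun y => twist E 0 1 p (fderiv ℝ α y)) x :=
    ((contDiffOn_twist 0 1 hU hα).contDiffAt (hU.mem_nhds hx)).differentiableAt (by simp)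
  have hα' : ContDiffOn ℝ ∞ (fun y => (α y).compContinuousLinearMap (-mulI E)) U :=
    (ContinuousAlternatingMap.compContinuousLinearMapCLM (F := ℂ) (ι := Fin p)
      (-mulI E)).contDiff.comp_contDiffOn hα
  rw [twist_zero_one, alternatizeUncurryFin_fderiv_comp_mulI hd]
  have h : (fun y => (twist E 0 1 p (fderiv ℝ α y)).compContinuousLinearMap (-mulI E))
      =ᶠ[nhds x] extDeriv fun y => (α y).compContinuousLinearMap (-mulI E) := by
    filter_upwards [hU.mem_nhds hx] with y hy
    rw [twist_zero_one, alternatizeUncurryFin_fderiv_comp_mulI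
      ((hα.contDiffAt (hU.mem_nhds hy)).differentiableAt (by simp))]
    ext v
    simp [mulI_apply, smul_smul, Function.comp_def]
  rw [h.extDeriv_eq, extDeriv_extDeriv_apply (hα'.contDiffAt (hU.mem_nhds hx))
    (minSmoothness_two_le_infty)]
  rfl

/-- `∂∂̄ = (i/4) (d T - T d)`, where `T` is the exterior derivative rotated by `i`. -/
theorem flatDel_flatDelbar_eq (hU : IsOpen U) (hα : ContDiffOn ℝ ∞ α U) (hx : x ∈ U) :
    flatDel (flatDelbar α) x = (Complex.I / 4) •
      (twist E 1 0 _ (fderiv ℝ (fun y => twist E 0 1 p (fderiv ℝ α y)) x) -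
        twist E 0 1 _ (fderiv ℝ (fun y => twist E 1 0 p (fderiv ℝ α y)) x)) := by
  have hd (a b : ℂ) : DifferentiableAt ℝ (fun y => twist E a b p (fderiv ℝ α y)) x :=
    ((contDiffOn_twist a b hU hα).contDiffAt (hU.mem_nhds hx)).differentiableAt (by simp)
  have h1 : fderiv ℝ (flatDelbar α) x =
      (1 / 2 : ℂ) • fderiv ℝ (fun y => twist E 1 0 p (fderiv ℝ α y)) x +
        (Complex.I / 2) • fderiv ℝ (fun y => twist E 0 1 p (fderiv ℝ α y)) x := by
    have h2 : flatDelbar α = (fun y => (1 / 2 : ℂ) • twist E 1 0 p (fderiv ℝ α y) +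
        (Complex.I / 2) • twist E 0 1 p (fderiv ℝ α y)) := by
      funext y
      rw [flatDelbar_eq_twist, twist_eq_add]
    rw [h2]
    exact (((hd 1 0).hasFDerivAt.const_smul (1 / 2 : ℂ)).add
      ((hd 0 1).hasFDerivAt.const_smul (Complex.I / 2))).fderiv
  -- Expands `(d - iT)(d + iT) / 4`; the terms `d ^ 2` and `T ^ 2` vanish.
  rw [flatDel_eq_twist, twist_eq_add, h1, map_add, map_add, twist_csmul, twist_csmul, twist_csmul,
    twist_csmul, twist_one_zero_twist_one_zero hU hα hx, twist_zero_one_twist_zero_one hU hα hx]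
  ext v
  simp
  ring

/-- `i ∂∂̄` is a real operator. -/
theorem isRealForm_I_smul_flatDel_flatDelbar (hU : IsOpen U) (hα : ContDiffOn ℝ ∞ α U) (hx : x ∈ U)
    (hr : ∀ y ∈ U, IsRealForm (α y)) (v : Fin (p + 1 + 1) → E) :
    (Complex.I * flatDel (flatDelbar α) x v).im = 0 := by
  have h (a b c d : ℂ) (ha : a.im = 0) (hb : b.im = 0) (hc : c.im = 0) (hd : d.im = 0) :
      IsRealForm (twist E c d _ (fderiv ℝ (fun y => twist E a b p (fderiv ℝ α y)) x)) := by
    refine isRealForm_twist (isRealForm_fderiv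
      (((contDiffOn_twist a b hU hα).contDiffAt (hU.mem_nhds hx)).differentiableAt (by simp))
      ?_) hc hd
    filter_upwards [hU.mem_nhds hx] with y hy
    refine isRealForm_twist (isRealForm_fderiv
      ((hα.contDiffAt (hU.mem_nhds hy)).differentiableAt (by simp)) ?_) ha hb
    filter_upwards [hU.mem_nhds hy] with z hz using hr z hz
  have h1 := h 0 1 1 0 (by simp) (by simp) (by simp) (by simp) v
  have h2 := h 1 0 0 1 (by simp) (by simp) (by simp) (by simp) v
  rw [flatDel_flatDelbar_eq hU hα hx, ContinuousAlternatingMap.smul_apply,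
    ContinuousAlternatingMap.sub_apply, smul_eq_mul, ← mul_assoc,
    show Complex.I * (Complex.I / 4) = ((-1 / 4 : ℝ) : ℂ) by
      rw [← mul_div_assoc, Complex.I_mul_I]; push_cast; ring,
    Complex.im_ofReal_mul, Complex.sub_im, h1, h2]
  simp

end Real

/-! ### A smooth partition of unity subordinate to holomorphic charts. -/

section Partition

variable {E : Type*} [NormedAddCommGroup E] [NormedSpace ℂ E]
  {X : Type*} [TopologicalSpace X] [ChartedSpace E X]

/-- A complex manifold is a real smooth manifold. -/
theorem isManifold_real [IsManifold 𝓘(ℂ, E) ω X] : IsManifold 𝓘(ℝ, E) ∞ X := by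
  refine isManifold_of_contDiffOn _ _ _ fun e e' he he' => ?_
  have h := ((contDiffGroupoid ω 𝓘(ℂ, E)).compatible he he').1
  have h2 : ContDiffOn ℂ ω (e.symm ≫ₕ e') (e.symm ≫ₕ e').source := by
    simpa [contDiffPregroupoid] using h
  have h3 : ContDiffOn ℝ ∞ (e.symm ≫ₕ e') (e.symm ≫ₕ e').source :=
    (h2.restrict_scalars ℝ).of_le le_top
  simpa using h3

/-- A finite partition of unity subordinate to the preferred charts. -/
theorem exists_chart_partition [FiniteDimensional ℂ E] [IsManifold 𝓘(ℂ, E) ω X] [T2Space X]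
    [CompactSpace X] :
    ∃ (t : Finset X) (ρ : t → X → ℝ),
      (∀ i x₀, ContDiffOn ℝ ∞ (fun y => ρ i ((chartAt E x₀).symm y)) (chartAt E x₀).target) ∧
      (∀ i x, 0 ≤ ρ i x) ∧ (∀ x, ∑ i, ρ i x = 1) ∧
      ∀ i : t, tsupport (ρ i) ⊆ (chartAt E (i : X)).source := by
  have : FiniteDimensional ℝ E := FiniteDimensional.complexToReal E
  have : IsManifold 𝓘(ℝ, E) ∞ X := isManifold_real
  obtain ⟨t, ht⟩ := isCompact_univ.elim_finite_subcover (fun x : X => (chartAt E x).source)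
    (fun x => (chartAt E x).open_source)
    fun x _ => Set.mem_iUnion_of_mem x (mem_chart_source E x)
  obtain ⟨f, hf⟩ := SmoothPartitionOfUnity.exists_isSubordinate 𝓘(ℝ, E) (isClosed_univ (X := X))
    (fun i : t => (chartAt E (i : X)).source) (fun i => (chartAt E (i : X)).open_source)
    (fun x hx => by simpa using ht hx)
  refine ⟨t, fun i => f i, fun i x₀ => ?_, f.nonneg, fun x => ?_, hf⟩
  · rw [← contMDiffOn_iff_contDiffOn]
    exact (f i).contMDiff.comp_contMDiffOn (contMDiffOn_chart_symm (I := 𝓘(ℝ, E)) (x := x₀))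
  · rw [← finsum_eq_sum_of_fintype]
    exact f.sum_eq_one (Set.mem_univ x)

end Partition

/-! ### Integrals of exact forms with compact support in a vector space. -/

section FlatIntegral

open MeasureTheory

variable {E : Type*} [NormedAddCommGroup E] [NormedSpace ℂ E] [FiniteDimensional ℂ E]
  [MeasurableSpace E] [BorelSpace E] (μ : Measure E) [μ.IsAddHaarMeasure]

theorem integral_fderiv_eq_zero {f : E → ℂ} (hf : ContDiff ℝ ∞ f) (hc : HasCompactSupport f)
    (v : E) : ∫ x, fderiv ℝ f x v ∂μ = 0 := by
  have : FiniteDimensional ℝ E := FiniteDimensional.complexToReal E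
  have h1 : Continuous fun x => fderiv ℝ f x v :=
    (hf.continuous_fderiv (by simp)).clm_apply continuous_const
  have h2 : Integrable (fun x => fderiv ℝ f x v) μ :=
    h1.integrable_of_hasCompactSupport (hc.fderiv_apply ℝ v)
  have h3 : Integrable f μ := hf.continuous.integrable_of_hasCompactSupport hc
  -- Integration by parts against the constant function one.
  have h := integral_mul_fderiv_eq_neg_fderiv_mul_of_integrable (μ := μ) (f := fun _ : E => (1 : ℂ))
    (g := f) (v := v) (by simp) (by simpa using h2) (by simpa using h3)
    (fun _ _ => differentiableAt_const _) fun x _ => hf.differentiable (by simp) x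
  simpa using h

/-- The integral of `∂α` or `∂̄α` for a form with compact support vanishes. -/
theorem integral_twist_eq_zero {p : ℕ} (a b : ℂ) {α : E → E [⋀^Fin p]→L[ℝ] ℂ}
    (hα : ContDiff ℝ ∞ α) (hc : HasCompactSupport α) (w : Fin (p + 1) → E) :
    ∫ x, twist E a b p (fderiv ℝ α x) w ∂μ = 0 := by
  have : FiniteDimensional ℝ E := FiniteDimensional.complexToReal E
  have hcd (u : Fin p → E) : ContDiff ℝ ∞ fun x => α x u :=
    (ContinuousAlternatingMap.apply ℝ E ℂ u).contDiff.comp hα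
  have hcs (u : Fin p → E) : HasCompactSupport fun x => α x u :=
    hc.comp_left (g := fun a : E [⋀^Fin p]→L[ℝ] ℂ => a u) rfl
  have hi (u : Fin p → E) (v : E) : Integrable (fun x => fderiv ℝ (fun y => α y u) x v) μ :=
    (((hcd u).continuous_fderiv (by simp)).clm_apply
      continuous_const).integrable_of_hasCompactSupport ((hcs u).fderiv_apply ℝ v)
  have hexp (x : E) : twist E a b p (fderiv ℝ α x) w = ∑ i : Fin (p + 1),
      (-1 : ℂ) ^ (i : ℕ) * (a * fderiv ℝ (fun y => α y (i.removeNth w)) x (w i) +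
        b * fderiv ℝ (fun y => α y (i.removeNth w)) x (Complex.I • w i)) := by
    rw [twist_apply, ContinuousAlternatingMap.alternatizeUncurryFin_apply]
    refine Finset.sum_congr rfl fun i _ => ?_
    rw [fderiv_continuousAlternatingMap_apply_const_apply (hα.differentiable (by simp) x),
      fderiv_continuousAlternatingMap_apply_const_apply (hα.differentiable (by simp) x)]
    simp [mulI_apply, mul_add]
  simp only [hexp]
  have hint (i : Fin (p + 1)) : Integrable (fun x =>
      (-1 : ℂ) ^ (i : ℕ) * (a * fderiv ℝ (fun y => α y (i.removeNth w)) x (w i) +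
        b * fderiv ℝ (fun y => α y (i.removeNth w)) x (Complex.I • w i))) μ :=
    Integrable.const_mul (((hi _ _).const_mul a).add ((hi _ _).const_mul b)) _
  rw [integral_finsetSum _ fun i _ => hint i]
  refine Finset.sum_eq_zero fun i _ => ?_
  rw [integral_const_mul, integral_add ((hi _ _).const_mul a) ((hi _ _).const_mul b),
    integral_const_mul, integral_const_mul, integral_fderiv_eq_zero μ (hcd _) (hcs _),
    integral_fderiv_eq_zero μ (hcd _) (hcs _)]
  simp

/-- A variant for forms which are smooth on an open set and have compact support inside it. -/
theorem setIntegral_twist_eq_zero {p : ℕ} (a b : ℂ) {α : E → E [⋀^Fin p]→L[ℝ] ℂ} {U K : Set E}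
    (hU : IsOpen U) (hK : IsCompact K) (hKU : K ⊆ U) (hα : ContDiffOn ℝ ∞ α U)
    (h0 : ∀ y ∈ U \ K, α y = 0) (w : Fin (p + 1) → E) :
    ∫ x in U, twist E a b p (fderiv ℝ α x) w ∂μ = 0 := by
  have hKc : ∀ y, y ∉ K → U.indicator α y = 0 := fun y hy => by
    by_cases hyU : y ∈ U
    · rw [Set.indicator_of_mem hyU, h0 y ⟨hyU, hy⟩]
    · exact Set.indicator_of_notMem hyU _
  have heqU (y : E) (hy : y ∈ U) : U.indicator α =ᶠ[nhds y] α := by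
    filter_upwards [hU.mem_nhds hy] with z hz
    exact Set.indicator_of_mem hz _
  -- The extension by zero agrees with `α` near points of `U` and vanishes near all other points,
  -- since `K` is closed.
  have hsm : ContDiff ℝ ∞ (U.indicator α) := by
    rw [contDiff_iff_contDiffAt]
    intro y
    by_cases hy : y ∈ U
    · exact (hα.contDiffAt (hU.mem_nhds hy)).congr_of_eventuallyEq (heqU y hy)
    · have : U.indicator α =ᶠ[nhds y] fun _ => 0 := by
        filter_upwards [hK.isClosed.isOpen_compl.mem_nhds fun h => hy (hKU h)] with z hz
        exact hKc z hz
      exact contDiffAt_const.congr_of_eventuallyEq this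
  have hcs : HasCompactSupport (U.indicator α) := HasCompactSupport.intro hK hKc
  rw [← integral_twist_eq_zero μ a b hsm hcs w, ← integral_indicator hU.measurableSet]
  congr 1
  funext y
  by_cases hy : y ∈ U
  · rw [Set.indicator_of_mem hy, (heqU y hy).fderiv_eq]
  · have : U.indicator α =ᶠ[nhds y] fun _ => 0 := by
      filter_upwards [hK.isClosed.isOpen_compl.mem_nhds fun h => hy (hKU h)] with z hz
      exact hKc z hz
    rw [Set.indicator_of_notMem hy, this.fderiv_eq, fderiv_fun_const]
    simp

end FlatIntegral

/-! ### Stokes' theorem on a compact complex manifold, with preliminaries on charts. -/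

section Charts

variable {E : Type*} [NormedAddCommGroup E] {X : Type*} [TopologicalSpace X] [ChartedSpace E X]

theorem eventually_chart_symm {P : X → Prop} {x : X} (h : ∀ᶠ x' in nhds x, P x') :
    ∀ᶠ y in nhds (chartAt E x x), P ((chartAt E x).symm y) := by
  have h1 := (chartAt E x).symm.continuousAt
    (x := chartAt E x x) (by simp)
  rw [ContinuousAt, (chartAt E x).left_inv (mem_chart_source E x)] at h1
  exact h1.eventually h

theorem isCompact_chart_image {K : Set X} {x₀ : X} (hK : IsCompact K)
    (hKs : K ⊆ (chartAt E x₀).source) : IsCompact (chartAt E x₀ '' K) :=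
  hK.image_of_continuousOn ((chartAt E x₀).continuousOn.mono hKs)

theorem notMem_of_notMem_chart_image {K : Set X} {x₀ : X} {y : E}
    (hy : y ∈ (chartAt E x₀).target \ (chartAt E x₀ '' K)) : (chartAt E x₀).symm y ∉ K :=
  fun h => hy.2 ⟨_, h, (chartAt E x₀).right_inv hy.1⟩

end Charts

section FormSMul

variable {E : Type*} [NormedAddCommGroup E] [NormedSpace ℂ E] {p : ℕ}

theorem form_zero_smul (η : E [⋀^Fin p]→L[ℝ] ℂ) : (0 : ℝ) • η = 0 := by
  ext v
  simp

theorem form_smul_zero (r : ℝ) : r • (0 : E [⋀^Fin p]→L[ℝ] ℂ) = 0 := by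
  ext v
  simp

theorem form_sum_smul {ι : Type*} [Fintype ι] {r : ι → ℝ} (hr : ∑ i, r i = 1)
    (η : E [⋀^Fin p]→L[ℝ] ℂ) : ∑ i, r i • η = η := by
  ext v
  rw [ContinuousAlternatingMap.sum_apply]
  simp only [ContinuousAlternatingMap.smul_apply]
  rw [← Finset.sum_smul, hr, one_smul]

end FormSMul

section Stokes

open MeasureTheory

variable {E : Type*} [NormedAddCommGroup E] [NormedSpace ℂ E]
  {X : Type*} [TopologicalSpace X] [ChartedSpace E X]

theorem pullback_id {p : ℕ} (α : DForm E X p) : pullback (fun x : X => x) α = α := by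
  funext x
  rw [pullback, realDifferential_id]
  rfl

theorem inChart_apply {p : ℕ} (α : DForm E X p) (x₀ : X) (y : E) (w : Fin p → E) :
    inChart α x₀ y w = α ((chartAt E x₀).symm y)
      (fun i => realDifferential (chartAt E x₀).symm y (w i)) := rfl

theorem inChart_eq_zero {p : ℕ} {α : DForm E X p} {x₀ : X} {y : E}
    (h : α ((chartAt E x₀).symm y) = 0) : inChart α x₀ y = 0 := by
  ext w
  rw [inChart_apply, h]
  rfl

theorem inChart_sum {p : ℕ} {ι : Type*} (s : Finset ι) (α : ι → DForm E X p) (x₀ : X) :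
    inChart (fun x => ∑ i ∈ s, α i x) x₀ = fun y => ∑ i ∈ s, inChart (α i) x₀ y := by
  funext y
  ext w
  simp only [inChart_apply, ContinuousAlternatingMap.sum_apply]

theorem inChart_smul {p : ℕ} (r : X → ℝ) (α : DForm E X p) (x₀ : X) :
    inChart (fun x => r x • α x) x₀ = fun y => r ((chartAt E x₀).symm y) • inChart α x₀ y := by
  funext y
  ext w
  simp only [inChart_apply, ContinuousAlternatingMap.smul_apply]

theorem IsSmooth.smul {p : ℕ} {r : X → ℝ} {α : DForm E X p} (hα : IsSmooth α)
    (hr : ∀ x₀, ContDiffOn ℝ ∞ (fun y => r ((chartAt E x₀).symm y)) (chartAt E x₀).target) :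
    IsSmooth fun x => r x • α x := fun x₀ => by
  rw [inChart_smul]
  exact (hr x₀).smul (hα x₀)

theorem twistForm_eq_zero {p : ℕ} (a b : ℂ) {α : DForm E X p} {x : X}
    (h : ∀ᶠ x' in nhds x, α x' = 0) : twistForm a b α x = 0 := by
  have h1 : inChart α x =ᶠ[nhds (chartAt E x x)] fun _ => 0 :=
    (eventually_chart_symm h).mono fun y hy => inChart_eq_zero hy
  rw [twistForm, h1.fderiv_eq, fderiv_fun_const]
  simp

theorem twistForm_sum {p : ℕ} (a b : ℂ) {ι : Type*} (s : Finset ι) {α : ι → DForm E X p}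
    (hα : ∀ i ∈ s, IsSmooth (α i)) (x : X) :
    twistForm a b (fun x => ∑ i ∈ s, α i x) x = ∑ i ∈ s, twistForm a b (α i) x := by
  simp only [twistForm]
  rw [inChart_sum, fderiv_fun_sum, map_sum]
  intro i hi
  exact ((hα i hi x).contDiffAt ((chartAt E x).open_target.mem_nhds
    (mem_chart_target E x))).differentiableAt (by simp)

variable [MeasurableSpace E] [BorelSpace E] (μ : Measure E)

/-- The integral of a form of top degree over a chart; `w` is an orienting tuple. -/
def chartIntegral {m : ℕ} (w : Fin m → E) (ζ : DForm E X m) (x₀ : X) : ℂ :=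
  ∫ y in (chartAt E x₀).target, inChart ζ x₀ y w ∂μ

variable [μ.IsAddHaarMeasure]

theorem integrableOn_inChart {m : ℕ} (w : Fin m → E) {ζ : DForm E X m} (hζ : IsSmooth ζ) {x₀ : X}
    {K : Set X} (hK : IsCompact K) (hKs : K ⊆ (chartAt E x₀).source) (h0 : ∀ x ∉ K, ζ x = 0) :
    IntegrableOn (fun y => inChart ζ x₀ y w) (chartAt E x₀).target μ := by
  have hsub : chartAt E x₀ '' K ⊆ (chartAt E x₀).target := by
    rintro _ ⟨x, hx, rfl⟩
    exact (chartAt E x₀).map_source (hKs hx)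
  have hc : ContinuousOn (fun y => inChart ζ x₀ y w) (chartAt E x₀ '' K) :=
    (ContinuousAlternatingMap.apply ℝ E ℂ w).continuous.comp_continuousOn
      ((hζ x₀).continuousOn.mono hsub)
  refine (hc.integrableOn_compact (isCompact_chart_image hK hKs)).of_forall_sdiff_eq_zero
    (chartAt E x₀).open_target.measurableSet fun y hy => ?_
  rw [inChart_eq_zero (h0 _ (notMem_of_notMem_chart_image hy))]
  rfl

variable [FiniteDimensional ℂ E]

/-- Both integrals live on the overlap of the charts, where the change of variables applies.
Transition maps are holomorphic, so their real Jacobian is nonnegative and equals its absolute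
value: complex charts are coherently oriented. -/
theorem chartIntegral_eq [IsManifold 𝓘(ℂ, E) ω X] {m : ℕ} (hm : Module.finrank ℝ E = m)
    (w : Fin m → E) {ζ : DForm E X m} {x₁ x₂ : X} (h1 : ∀ x ∉ (chartAt E x₁).source, ζ x = 0)
    (h2 : ∀ x ∉ (chartAt E x₂).source, ζ x = 0) :
    chartIntegral μ w ζ x₁ = chartIntegral μ w ζ x₂ := by
  have : FiniteDimensional ℝ E := FiniteDimensional.complexToReal E
  let D (x x' : X) : Set E := coordDomain (E := E) (fun x : X => x) Set.univ x x'
  let τ (x x' : X) (y : E) : E := chartAt E x' ((chartAt E x).symm y)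
  have hid : ContMDiffOn 𝓘(ℂ, E) 𝓘(ℂ, E) ω (fun x : X => x) Set.univ := contMDiffOn_id
  have hDo (x x' : X) : IsOpen (D x x') := isOpen_coordDomain isOpen_univ hid x x'
  have hmem (x x' : X) (y : E) (hy : y ∈ D x x') : τ x x' y ∈ D x' x := by
    refine ⟨(chartAt E x').map_source hy.2.2, trivial, ?_⟩
    have h := (chartAt E x').left_inv hy.2.2
    exact h.symm ▸ (chartAt E x).map_target hy.1
  have hinv (x x' : X) (y : E) (hy : y ∈ D x x') : τ x' x (τ x x' y) = y := by
    have h : (chartAt E x').symm (chartAt E x' ((chartAt E x).symm y)) = (chartAt E x).symm y :=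
      (chartAt E x').left_inv hy.2.2
    simp only [τ]
    rw [h]
    exact (chartAt E x).right_inv hy.1
  have hres (x x' : X) (h0 : ∀ x ∉ (chartAt E x').source, ζ x = 0) :
      chartIntegral μ w ζ x = ∫ y in D x x', inChart ζ x y w ∂μ := by
    refine setIntegral_eq_of_subset_of_forall_sdiff_eq_zero
      (chartAt E x).open_target.measurableSet (fun y hy => hy.1) fun y hy => ?_
    rw [inChart_eq_zero (h0 _ fun h => hy.2 ⟨hy.1, trivial, h⟩)]
    rfl
  rw [hres x₁ x₂ h2, hres x₂ x₁ h1]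
  have himg : D x₂ x₁ = τ x₁ x₂ '' D x₁ x₂ :=
    Set.Subset.antisymm (fun y hy => ⟨τ x₂ x₁ y, hmem _ _ y hy, hinv _ _ y hy⟩)
      (by rintro _ ⟨y, hy, rfl⟩; exact hmem _ _ y hy)
  have hτ : ∀ y ∈ D x₁ x₂, DifferentiableAt ℂ (τ x₁ x₂) y := fun y hy =>
    ((contDiffOn_coordDomain hid x₁ x₂).contDiffAt ((hDo x₁ x₂).mem_nhds hy)).differentiableAt
      (by simp)
  rw [himg, integral_image_eq_integral_abs_det_fderiv_smul μ (hDo x₁ x₂).measurableSet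
    (f' := fun y => fderiv ℝ (τ x₁ x₂) y)
    (fun y hy => ((hτ y hy).restrictScalars ℝ).hasFDerivAt.hasFDerivWithinAt)
    (Set.LeftInvOn.injOn (f₁' := τ x₂ x₁) fun y hy => hinv _ _ y hy)]
  refine setIntegral_congr_fun (hDo x₁ x₂).measurableSet fun y hy => ?_
  have hp := inChart_pullback isOpen_univ hid ζ x₁ x₂ hy
  rw [pullback_id] at hp
  have hdet : 0 ≤ (fderiv ℝ (τ x₁ x₂) y).det := by
    rw [(hτ y hy).fderiv_restrictScalars ℝ]
    have h : LinearMap.det ((fderiv ℂ (τ x₁ x₂) y : E →ₗ[ℂ] E).restrictScalars ℝ) = _ :=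
      LinearMap.det_restrictScalars
    rw [Algebra.norm_complex_apply] at h
    exact (Complex.normSq_nonneg _).trans_eq h.symm
  rw [hp, abs_of_nonneg hdet]
  exact top_form_comp hm (inChart ζ x₂ (τ x₁ x₂ y)) (fderiv ℝ (τ x₁ x₂) y : E →ₗ[ℝ] E) w

theorem chartIntegral_twistForm_eq_zero [IsManifold 𝓘(ℂ, E) ω X] {p : ℕ} (a b : ℂ)
    (w : Fin (p + 1) → E) {α : DForm E X p} (hα : IsSmooth α) {x₀ : X} {K : Set X}
    (hK : IsCompact K) (hKs : K ⊆ (chartAt E x₀).source) (h0 : ∀ x ∉ K, α x = 0) :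
    chartIntegral μ w (twistForm a b α) x₀ = 0 := by
  have hsub : chartAt E x₀ '' K ⊆ (chartAt E x₀).target := by
    rintro _ ⟨x, hx, rfl⟩
    exact (chartAt E x₀).map_source (hKs hx)
  rw [← setIntegral_twist_eq_zero μ a b (chartAt E x₀).open_target (isCompact_chart_image hK hKs)
    hsub (hα x₀) (fun y hy => inChart_eq_zero (h0 _ (notMem_of_notMem_chart_image hy))) w]
  refine setIntegral_congr_fun (chartAt E x₀).open_target.measurableSet fun y hy => ?_
  rw [inChart_twistForm a b hα x₀ hy]

/-- Each `ρ i • ζ` is supported in both charts and can be integrated over the chart at `x₀`, where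
the functions `ρ i` add up to one. -/
theorem sum_chartIntegral_eq [IsManifold 𝓘(ℂ, E) ω X] [CompactSpace X] {m : ℕ}
    (hm : Module.finrank ℝ E = m) (w : Fin m → E) {t : Finset X} {ρ : t → X → ℝ}
    (hρ : ∀ i x₀, ContDiffOn ℝ ∞ (fun y => ρ i ((chartAt E x₀).symm y)) (chartAt E x₀).target)
    (hsum : ∀ x, ∑ i, ρ i x = 1) (hsupp : ∀ i : t, tsupport (ρ i) ⊆ (chartAt E (i : X)).source)
    {ζ : DForm E X m} (hζ : IsSmooth ζ) {x₀ : X} {K : Set X} (hK : IsCompact K)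
    (hKs : K ⊆ (chartAt E x₀).source) (h0 : ∀ x ∉ K, ζ x = 0) :
    ∑ i, chartIntegral μ w (fun x => ρ i x • ζ x) i = chartIntegral μ w ζ x₀ := by
  have h1 (i : t) : chartIntegral μ w (fun x => ρ i x • ζ x) i =
      chartIntegral μ w (fun x => ρ i x • ζ x) x₀ := by
    refine chartIntegral_eq μ hm w (fun x hx => ?_) fun x hx => ?_
    · rw [image_eq_zero_of_notMem_tsupport fun h => hx (hsupp i h), form_zero_smul]
    · rw [h0 x fun h => hx (hKs h), form_smul_zero]
  rw [Finset.sum_congr rfl fun i _ => h1 i]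
  simp only [chartIntegral]
  rw [← integral_finsetSum _ fun i _ => integrableOn_inChart μ w (hζ.smul (hρ i)) hK hKs
    fun x hx => by rw [h0 x hx, form_smul_zero]]
  refine setIntegral_congr_fun (chartAt E x₀).open_target.measurableSet fun y _ => ?_
  simp only [inChart_smul, ContinuousAlternatingMap.smul_apply]
  rw [← Finset.sum_smul, hsum, one_smul]

/-- **Stokes' theorem** for `∂` and `∂̄` on a compact complex manifold, in terms of a partition of
unity. -/
theorem sum_chartIntegral_twistForm_eq_zero [IsManifold 𝓘(ℂ, E) ω X] [CompactSpace X]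
    {p : ℕ} (hm : Module.finrank ℝ E = p + 1) (w : Fin (p + 1) → E) {t : Finset X} {ρ : t → X → ℝ}
    (hρ : ∀ i x₀, ContDiffOn ℝ ∞ (fun y => ρ i ((chartAt E x₀).symm y)) (chartAt E x₀).target)
    (hsum : ∀ x, ∑ i, ρ i x = 1) (hsupp : ∀ i : t, tsupport (ρ i) ⊆ (chartAt E (i : X)).source)
    (a b : ℂ) {α : DForm E X p} (hα : IsSmooth α) :
    ∑ i, chartIntegral μ w (fun x => ρ i x • twistForm a b α x) i = 0 := by
  have hK (i : t) : IsCompact (tsupport (ρ i)) := (isClosed_tsupport _).isCompact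
  have hsm (j : t) : IsSmooth fun x => ρ j x • α x := hα.smul (hρ j)
  have h0 (j : t) : ∀ x ∉ tsupport (ρ j), twistForm a b (fun x => ρ j x • α x) x = 0 := by
    intro x hx
    refine twistForm_eq_zero a b ?_
    filter_upwards [(isClosed_tsupport (ρ j)).isOpen_compl.mem_nhds hx] with x' hx'
    rw [image_eq_zero_of_notMem_tsupport hx', form_zero_smul]
  -- The same partition also cuts `α` into pieces supported in single charts; after exchanging the
  -- two sums, each piece integrates to zero in its own chart.
  have hdec : twistForm a b α = fun x => ∑ j, twistForm a b (fun x => ρ j x • α x) x := by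
    funext x
    rw [← twistForm_sum a b Finset.univ fun j _ => hsm j]
    congr 1
    funext x
    exact (form_sum_smul (hsum x) (α x)).symm
  have h1 (i : t) : chartIntegral μ w (fun x => ρ i x • twistForm a b α x) i =
      ∑ j, chartIntegral μ w (fun x => ρ i x • twistForm a b (fun x => ρ j x • α x) x) i := by
    simp only [chartIntegral]
    rw [← integral_finsetSum _ fun j _ => integrableOn_inChart μ w
      (((hsm j).twistForm a b).smul (hρ i)) (hK i) (hsupp i)
      fun x hx => by rw [image_eq_zero_of_notMem_tsupport hx, form_zero_smul]]
    refine setIntegral_congr_fun (chartAt E (i : X)).open_target.measurableSet fun y _ => ?_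
    simp only [inChart_smul, ContinuousAlternatingMap.smul_apply]
    rw [hdec, inChart_sum, ContinuousAlternatingMap.sum_apply, Finset.smul_sum]
  rw [Finset.sum_congr rfl fun i _ => h1 i, Finset.sum_comm]
  refine Finset.sum_eq_zero fun j _ => ?_
  rw [sum_chartIntegral_eq μ hm w hρ hsum hsupp ((hsm j).twistForm a b) (hK j) (hsupp j) (h0 j)]
  refine chartIntegral_twistForm_eq_zero μ a b w (hsm j) (hK j) (hsupp j) fun x hx => ?_
  rw [image_eq_zero_of_notMem_tsupport hx, form_zero_smul]

/-- On a compact complex manifold, a positive volume form times a nonzero constant is not in the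
image of `∂` or `∂̄`. -/
theorem eq_zero_of_twistForm_eq_smul [IsManifold 𝓘(ℂ, E) ω X] [CompactSpace X] [T2Space X]
    [Nonempty X] {p : ℕ} (hm : Module.finrank ℝ E = p + 1) (w : Fin (p + 1) → E) (a b : ℂ)
    {α : DForm E X p} (hα : IsSmooth α) {θ : DForm E X (p + 1)} (hθ : IsSmooth θ)
    (hpos : ∀ x₀, ∀ y ∈ (chartAt E x₀).target, ∃ s : ℝ, 0 < s ∧ inChart θ x₀ y w = s) {c : ℂ}
    (hc : ∀ x, twistForm a b α x = c • θ x) : c = 0 := by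
  obtain ⟨t, ρ, hρ, hnn, hsum, hsupp⟩ := exists_chart_partition (E := E) (X := X)
  let μ : Measure E := Measure.addHaarMeasure (Classical.choice inferInstance)
  have hst := sum_chartIntegral_twistForm_eq_zero μ hm w hρ hsum hsupp a b hα
  have : FiniteDimensional ℝ E := FiniteDimensional.complexToReal E
  choose! s hs hsθ using hpos
  have hval (i : t) (y : E) (hy : y ∈ (chartAt E (i : X)).target) :
      inChart (fun x => ρ i x • θ x) i y w =
        ((ρ i ((chartAt E (i : X)).symm y) * s i y : ℝ) : ℂ) := by
    rw [inChart_smul, ContinuousAlternatingMap.smul_apply, hsθ i y hy]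
    simp
  have hint (i : t) : IntegrableOn (fun y => ρ i ((chartAt E (i : X)).symm y) * s i y)
      (chartAt E (i : X)).target μ := by
    have h := (integrableOn_inChart μ w (hθ.smul (hρ i)) (isClosed_tsupport (ρ i)).isCompact
      (hsupp i) fun x hx => by rw [image_eq_zero_of_notMem_tsupport hx, form_zero_smul]).re
    refine IntegrableOn.congr_fun h (fun y hy => ?_) (chartAt E (i : X)).open_target.measurableSet
    simp only [hval i y hy]
    rfl
  -- `J i` is the integral of `ρ i • θ`, so Stokes reads `c * ∑ i, J i = 0`. All `J i` are
  -- nonnegative, and one is positive where its `ρ i` is.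
  let J (i : t) : ℝ := ∫ y in (chartAt E (i : X)).target, ρ i ((chartAt E (i : X)).symm y) * s i y ∂μ
  have hJ (i : t) : chartIntegral μ w (fun x => ρ i x • twistForm a b α x) i = c * J i := by
    rw [← integral_complex_ofReal, ← integral_const_mul]
    refine setIntegral_congr_fun (chartAt E (i : X)).open_target.measurableSet fun y hy => ?_
    change _ = c * (_ : ℂ)
    rw [← hval i y hy, inChart_apply, inChart_apply, hc]
    simp only [ContinuousAlternatingMap.smul_apply, smul_eq_mul, Complex.real_smul]
    ring
  rw [Finset.sum_congr rfl fun i _ => hJ i, ← Finset.mul_sum, ← Complex.ofReal_sum] at hst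
  refine (mul_eq_zero.1 hst).resolve_right ?_
  have hJnn (i : t) : 0 ≤ J i :=
    setIntegral_nonneg (chartAt E (i : X)).open_target.measurableSet fun y hy =>
      mul_nonneg (hnn _ _) (hs _ y hy).le
  obtain ⟨x⟩ := ‹Nonempty X›
  obtain ⟨i, hi⟩ : ∃ i, 0 < ρ i x := by
    by_contra! h
    have := Finset.sum_nonpos fun i (_ : i ∈ Finset.univ) => h i
    rw [hsum] at this
    linarith
  have hxs : x ∈ (chartAt E (i : X)).source := hsupp i (subset_tsupport _ hi.ne')
  have hJi : 0 < J i := by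
    refine (setIntegral_pos_iff_support_of_nonneg_ae ?_ (hint i)).2 ?_
    · refine (ae_restrict_mem (chartAt E (i : X)).open_target.measurableSet).mono fun y hy => ?_
      exact mul_nonneg (hnn _ _) (hs _ y hy).le
    · have ho : IsOpen ((chartAt E (i : X)).target ∩
          (fun y => ρ i ((chartAt E (i : X)).symm y)) ⁻¹' Set.Ioi 0) :=
        (hρ i i).continuousOn.isOpen_inter_preimage (chartAt E (i : X)).open_target isOpen_Ioi
      refine (ho.measure_pos μ ⟨chartAt E (i : X) x, (chartAt E (i : X)).map_source hxs, ?_⟩).trans_le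
        (measure_mono fun y hy => ⟨(mul_pos hy.2 (hs _ y hy.1)).ne', hy.1⟩)
      change 0 < ρ i _
      rwa [(chartAt E (i : X)).left_inv hxs]
  exact_mod_cast (Finset.sum_pos' (fun i _ => hJnn i) ⟨i, Finset.mem_univ i, hJi⟩).ne'

end Stokes

/-! ### The factor of the Gauduchon forms relative to `F ^ n`. -/

section TopFactor

variable {E : Type*} [NormedAddCommGroup E] [NormedSpace ℂ E]

/-- A form of degree `p`, regarded as a form of degree `q = p`. -/
def castForm {p q : ℕ} (h : p = q) (a : E [⋀^Fin p]→L[ℝ] ℂ) : E [⋀^Fin q]→L[ℝ] ℂ := h ▸ a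

theorem toRing_castForm {p q : ℕ} (h : p = q) (a : E [⋀^Fin p]→L[ℝ] ℂ) :
    toRing (castForm h a) = toRing a := by
  subst h
  rfl

theorem castForm_apply {p q : ℕ} (h : p = q) (a : E [⋀^Fin p]→L[ℝ] ℂ) (v : Fin q → E) :
    castForm h a v = a fun i => v (Fin.cast h i) := by
  subst h
  rfl

theorem exists_eq_mul_top_form {m : ℕ} [FiniteDimensional ℝ E] (hm : Module.finrank ℝ E = m)
    (η : E [⋀^Fin m]→L[ℝ] ℂ) {θ : E [⋀^Fin m]→L[ℝ] ℂ} {w : Fin m → E} (hw : θ w ≠ 0) :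
    ∃ c : ℂ, ∀ v, η v = c * θ v :=
  ⟨η w / θ w, fun v => by
    rw [div_mul_eq_mul_div, eq_div_iff hw, top_form_mul_comm hm η θ v w]⟩

theorem IsPositiveForm.comp {φ : E [⋀^Fin 2]→L[ℝ] ℂ} (hφ : IsPositiveForm φ) {L : E →L[ℂ] E}
    (hL : Function.Injective L) :
    IsPositiveForm (φ.compContinuousLinearMap (L.restrictScalars ℝ)) := by
  have h (u v : E) : φ.compContinuousLinearMap (L.restrictScalars ℝ) ![u, v] = φ ![L u, L v] := by
    rw [ContinuousAlternatingMap.compContinuousLinearMap_apply]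
    congr 1
    funext i
    fin_cases i <;> rfl
  refine ⟨fun v => hφ.real _, fun u v => ?_, fun v hv => ?_⟩
  · rw [h, h, map_smul, map_smul, hφ.map_I_smul]
  · rw [h, map_smul]
    exact hφ.pos _ fun h0 => hv (hL (h0.trans (map_zero L).symm))

end TopFactor

section Factor

variable {E : Type*} [NormedAddCommGroup E] [NormedSpace ℂ E]
  {X : Type*} [TopologicalSpace X] [ChartedSpace E X]
  {M : Type*} [TopologicalSpace M] [ChartedSpace E M]

theorem pullback_pullback {N : Type*} [TopologicalSpace N] [ChartedSpace E N] {p : ℕ}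
    {g : M → X} {f : N → M} (hg : MDifferentiable 𝓘(ℂ, E) 𝓘(ℂ, E) g)
    (hf : MDifferentiable 𝓘(ℂ, E) 𝓘(ℂ, E) f) (α : DForm E X p) :
    pullback f (pullback g α) = pullback (fun y => g (f y)) α := by
  funext x
  simp only [pullback]
  rw [realDifferential_comp (hg _) (hf _)]
  rfl

theorem realDifferential_chart_symm_self [IsManifold 𝓘(ℂ, E) ω X] (x : X) :
    realDifferential (chartAt E x).symm (chartAt E x x) = ContinuousLinearMap.id ℝ E := by
  have h : (fun y => chartAt E x ((chartAt E x).symm y)) =ᶠ[nhds (chartAt E x x)] fun y => y := by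
    filter_upwards [(chartAt E x).open_target.mem_nhds (mem_chart_target E x)] with y hy
    exact (chartAt E x).right_inv hy
  have h1 := realDifferential_eq_fderiv_chart (mdifferentiableAt_chart_symm (mem_chart_target E x))
  rw [(chartAt E x).left_inv (mem_chart_source E x)] at h1
  rw [h1, ← fderiv_id (𝕜 := ℝ) (x := chartAt E x x)]
  exact h.fderiv_eq

theorem inChart_self [IsManifold 𝓘(ℂ, E) ω X] {p : ℕ} (α : DForm E X p) (x : X) :
    inChart α x (chartAt E x x) = α x := by
  rw [inChart, pullback, realDifferential_chart_symm_self,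
    (chartAt E x).left_inv (mem_chart_source E x)]
  rfl

theorem injective_realDifferential_chart_symm [IsManifold 𝓘(ℂ, E) ω X] {x₀ : X} {y : E}
    (hy : y ∈ (chartAt E x₀).target) :
    Function.Injective (realDifferential (E := E) (chartAt E x₀).symm y) := by
  have h : (fun y => chartAt E x₀ ((chartAt E x₀).symm y)) =ᶠ[nhds y] fun y => y := by
    filter_upwards [(chartAt E x₀).open_target.mem_nhds hy] with y hy
    exact (chartAt E x₀).right_inv hy
  have h1 := realDifferential_comp (M := X) (X := E)
    (mdifferentiableAt_chart ((chartAt E x₀).map_target hy))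
    (mdifferentiableAt_chart_symm hy)
  rw [realDifferential_congr h, realDifferential_id] at h1
  intro u v huv
  have h2 := DFunLike.congr_fun h1
  simp only [ContinuousLinearMap.comp_apply, ContinuousLinearMap.id_apply] at h2
  rw [h2 u, h2 v, huv]

/-- The outer `∂` needs `∂̄α` in the single chart at `x` on a whole neighbourhood;
`inChart_twistForm` provides it. -/
theorem del_delbar_apply [IsManifold 𝓘(ℂ, E) ω X] {p : ℕ} {α : DForm E X p} (hα : IsSmooth α)
    (x : X) : del (delbar α) x = flatDel (flatDelbar (inChart α x)) (chartAt E x x) := by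
  have h : inChart (delbar α) x =ᶠ[nhds (chartAt E x x)] flatDelbar (inChart α x) := by
    filter_upwards [(chartAt E x).open_target.mem_nhds (mem_chart_target E x)] with y hy
    rw [delbar_eq_twistForm, inChart_twistForm _ _ hα x hy, flatDelbar_eq_twist]
  rw [del, flatDel, flatDel, h.fderiv_eq]

namespace HermitianMetric

variable (F : HermitianMetric E X)

theorem isPositiveForm_form (x : X) : IsPositiveForm (F.form x) :=
  ⟨F.real x, F.map_I_smul x, F.pos x⟩

theorem isPositiveForm_pullback {h : M → X} {m : M}
    (hinj : Function.Injective (realDifferential (E := E) h m)) :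
    IsPositiveForm (pullback h F.form m) :=
  IsPositiveForm.comp (F.isPositiveForm_form (h m)) hinj

theorem inChart_pow (k : ℕ) (x₀ : X) :
    inChart (F.pow k) x₀ = fun y => wedgePow (inChart F.form x₀ y) k :=
  funext fun _ => wedgePow_comp _ _ _

theorem toRing_gauduchonForm_sub_one (n : ℕ) (x : X) :
    toRing (F.gauduchonForm n (n - 1) x) =
      toRing (Gauduchon.del (Gauduchon.delbar (F.pow (n - 1))) x) := by
  rw [gauduchonForm, toRing_wedge, pow, toRing_wedgePow, show n - (n - 1) - 1 = 0 by omega,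
    pow_zero, mul_one]

theorem isKthGauduchon_sub_one_iff (n : ℕ) : F.IsKthGauduchon n (n - 1) ↔ F.IsGauduchon n := by
  refine forall_congr' fun x => ?_
  rw [← toRing_injective.eq_iff, toRing_zero, toRing_gauduchonForm_sub_one,
    ← toRing_injective.eq_iff, toRing_zero]

/-- `(i/2) ∂∂̄(F ^ k) ∧ F ^ (n - k - 1) = c F ^ n` at the point `x`. -/
def IsFactorAt (n k : ℕ) (hk : k + 1 ≤ n) (x : X) (c : ℂ) : Prop :=
  ∀ v : Fin (2 * n) → E,
    Complex.I / 2 * F.gauduchonForm n k x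
        (fun i => v (Fin.cast (show 2 * k + 1 + 1 + 2 * (n - k - 1) = 2 * n by omega) i)) =
      c * F.pow n x v

variable {F}

theorem IsFactorAt.gauduchonForm_eq_zero {n k : ℕ} {hk : k + 1 ≤ n} {x : X}
    (h : F.IsFactorAt n k hk x 0) : F.gauduchonForm n k x = 0 := by
  apply toRing_injective
  rw [toRing_zero, ← toRing_zero (E := E) (p := 2 * n), toRing_eq_iff
    (show 2 * k + 1 + 1 + 2 * (n - k - 1) = 2 * n by omega)]
  intro v
  have h1 := h v
  rw [zero_mul] at h1
  exact (mul_eq_zero.1 h1).resolve_left (by simp)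

theorem isFactorAt_zero {n k : ℕ} (hk : k + 1 ≤ n) {x : X}
    (h : F.gauduchonForm n k x = 0) : F.IsFactorAt n k hk x 0 := by
  intro v
  rw [h, zero_mul]
  exact mul_zero _

section FiniteDimensional

variable [FiniteDimensional ℂ E] {n k : ℕ} (hdim : Module.finrank ℂ E = n)

include hdim

theorem exists_pow_ne_zero (x : X) : ∃ w, F.pow n x w ≠ 0 := by
  obtain ⟨w, hw⟩ := exists_tuple_wedgePow_pos hdim
  obtain ⟨s, hs, hs'⟩ := hw _ (F.isPositiveForm_form x)
  exact ⟨w, by rw [pow, hs']; exact_mod_cast hs.ne'⟩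

theorem exists_isFactorAt (hk : k + 1 ≤ n) (x : X) : ∃ c, F.IsFactorAt n k hk x c := by
  have : FiniteDimensional ℝ E := FiniteDimensional.complexToReal E
  obtain ⟨w, hw⟩ := exists_pow_ne_zero (F := F) hdim x
  obtain ⟨c, hc⟩ := exists_eq_mul_top_form (finrank_real_eq hdim)
    (castForm (show 2 * k + 1 + 1 + 2 * (n - k - 1) = 2 * n by omega) (F.gauduchonForm n k x)) hw
  refine ⟨Complex.I / 2 * c, fun v => ?_⟩
  rw [← castForm_apply, hc, mul_assoc]

theorem IsFactorAt.unique {hk : k + 1 ≤ n} {x : X} {c c' : ℂ} (h : F.IsFactorAt n k hk x c)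
    (h' : F.IsFactorAt n k hk x c') : c = c' := by
  obtain ⟨w, hw⟩ := exists_pow_ne_zero (F := F) hdim x
  exact mul_right_cancel₀ hw ((h w).symm.trans (h' w))

/-- On a tuple where `F ^ n` is a positive real number, the other side is real because `i∂∂̄`
preserves real forms. -/
theorem IsFactorAt.im_eq_zero [IsManifold 𝓘(ℂ, E) ω X] {hk : k + 1 ≤ n} {x : X} {c : ℂ}
    (h : F.IsFactorAt n k hk x c) : c.im = 0 := by
  obtain ⟨w, hw⟩ := exists_tuple_wedgePow_pos hdim
  obtain ⟨s, hs, hs'⟩ := hw _ (F.isPositiveForm_form x)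
  have h1 : IsRealForm (Complex.I • Gauduchon.del (Gauduchon.delbar (F.pow k)) x) := by
    intro v
    rw [del_delbar_apply (F.isSmooth_pow k)]
    refine isRealForm_I_smul_flatDel_flatDelbar (chartAt E x).open_target (F.isSmooth_pow k x)
      (mem_chart_target E x) (fun y _ => ?_) v
    rw [inChart_pow]
    exact IsRealForm.wedgePow (show IsRealForm (inChart F.form x y) from fun v => F.real _ _) k
  have h2 : IsRealForm (F.pow (n - k - 1) x) := IsRealForm.wedgePow (F.real x) _
  have h3 := h1.wedge h2
  rw [wedge_smul_left] at h3
  have h4 := h w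
  rw [pow, hs'] at h4
  have h5 := h3 (fun i => w (Fin.cast (show 2 * k + 1 + 1 + 2 * (n - k - 1) = 2 * n by omega) i))
  rw [ContinuousAlternatingMap.smul_apply, smul_eq_mul] at h5
  change (Complex.I * F.gauduchonForm n k x _).im = 0 at h5
  have h6 : (c * (s : ℂ)).im = 0 := by
    rw [← h4, div_mul_eq_mul_div, Complex.div_ofNat_im, h5, zero_div]
  rw [Complex.im_mul_ofReal] at h6
  exact (mul_eq_zero.1 h6).resolve_right hs.ne'

/-- Pulled back to `m`, both factor equations become the same equation in the common pullback of
`F`, whose top power is nonzero by injectivity of the differential. The intended maps are `π` and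
`π` after a translation. -/
theorem IsFactorAt.eq_of_pullback_eq [IsManifold 𝓘(ℂ, E) ω X] [IsManifold 𝓘(ℂ, E) ω M]
    {h₁ h₂ : M → X} (hh₁ : ContMDiff 𝓘(ℂ, E) 𝓘(ℂ, E) ω h₁)
    (hh₂ : ContMDiff 𝓘(ℂ, E) 𝓘(ℂ, E) ω h₂) (heq : pullback h₁ F.form = pullback h₂ F.form) {m : M}
    (hinj : Function.Injective (realDifferential (E := E) h₁ m)) {hk : k + 1 ≤ n} {c₁ c₂ : ℂ}
    (hc₁ : F.IsFactorAt n k hk (h₁ m) c₁) (hc₂ : F.IsFactorAt n k hk (h₂ m) c₂) : c₁ = c₂ := by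
  obtain ⟨w, hw⟩ := exists_tuple_wedgePow_pos hdim
  obtain ⟨s, hs, hs'⟩ := hw _ (F.isPositiveForm_pullback hinj)
  have h1 : pullback h₁ (F.gauduchonForm n k) m = pullback h₂ (F.gauduchonForm n k) m := by
    rw [F.pullback_gauduchonForm hh₁, F.pullback_gauduchonForm hh₂, heq]
  have h2 : F.pow n (h₁ m) (fun i => realDifferential h₁ m (w i)) = s := by
    rw [← hs', pullback, ← wedgePow_comp]
    rfl
  have h3 : F.pow n (h₂ m) (fun i => realDifferential h₂ m (w i)) = s := by
    rw [← hs', heq, pullback, ← wedgePow_comp]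
    rfl
  have h4 := hc₁ fun i => realDifferential h₁ m (w i)
  have h5 := hc₂ fun i => realDifferential h₂ m (w i)
  rw [h2] at h4
  rw [h3] at h5
  have h6 := DFunLike.congr_fun h1
    (fun i => w (Fin.cast (show 2 * k + 1 + 1 + 2 * (n - k - 1) = 2 * n by omega) i))
  have h7 : c₁ * (s : ℂ) = c₂ * s := by
    rw [← h4, ← h5]
    exact congrArg _ h6
  exact mul_right_cancel₀ (by exact_mod_cast hs.ne') h7

/-- For an invariant metric the factor does not depend on the point. -/
theorem IsInvariant.isFactorAt_congr [IsManifold 𝓘(ℂ, E) ω X] [IsManifold 𝓘(ℂ, E) ω M]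
    {G : Type*} [Group G] [MulAction G M] {π : M → X} (hF : F.IsInvariant G π) {hk : k + 1 ≤ n}
    {x y : X} {c : ℂ} (h : F.IsFactorAt n k hk x c) : F.IsFactorAt n k hk y c := by
  obtain ⟨m, rfl⟩ := hF.surjective x
  obtain ⟨m', rfl⟩ := hF.surjective y
  have := hF.transitive
  obtain ⟨g, rfl⟩ := MulAction.exists_smul_eq G m m'
  obtain ⟨c', hc'⟩ := exists_isFactorAt (F := F) hdim hk (π (g • m))
  have hπ : ContMDiff 𝓘(ℂ, E) 𝓘(ℂ, E) ω π := hF.localBiholomorphism.contMDiff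
  have heq : pullback π F.form = pullback (fun m => π (g • m)) F.form := by
    rw [← pullback_pullback (hπ.mdifferentiable (by simp))
      ((hF.holomorphic g).mdifferentiable (by simp)), hF.invariant g]
  have hinj : Function.Injective (realDifferential (E := E) π m) :=
    ((hF.localBiholomorphism m).mfderivToContinuousLinearEquiv (by simp)).injective
  rwa [IsFactorAt.eq_of_pullback_eq hdim hπ (hπ.comp (hF.holomorphic g)) heq hinj h hc']

/-- The factor as a function of `k`. -/
theorem exists_isFactorAt_quadratic [IsManifold 𝓘(ℂ, E) ω X] (hn : 3 ≤ n) (x : X) :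
    ∃ a b : ℂ, ∀ (j : ℕ) (hj : j + 1 + 1 ≤ n),
      F.IsFactorAt n (j + 1) hj x ((j + 1) * a + (j + 1) * j * b) := by
  have : FiniteDimensional ℝ E := FiniteDimensional.complexToReal E
  obtain ⟨w, hw⟩ := exists_pow_ne_zero (F := F) hdim x
  let φ := inChart F.form x
  let y := chartAt E x x
  -- The top forms `∂∂̄F ∧ F ^ (n - 2)` and `∂F ∧ ∂̄F ∧ F ^ (n - 3)` do not involve `j`: the powers
  -- of `F` from the expansion and from the definition combine.
  let A := castForm (show 2 + 1 + 1 + 2 * (n - 2) = 2 * n by omega)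
    (wedge (flatDel (flatDelbar φ) y) (F.pow (n - 2) x))
  let B := castForm (show 2 + 1 + (2 + 1) + 2 * (n - 3) = 2 * n by omega)
    (wedge (wedge (flatDel φ y) (flatDelbar φ y)) (F.pow (n - 3) x))
  obtain ⟨a, ha⟩ := exists_eq_mul_top_form (finrank_real_eq hdim) A hw
  obtain ⟨b, hb⟩ := exists_eq_mul_top_form (finrank_real_eq hdim) B hw
  refine ⟨Complex.I / 2 * a, Complex.I / 2 * b, fun j hj v => ?_⟩
  have hφ : φ y = F.form x := inChart_self _ _
  have key : toRing (F.gauduchonForm n (j + 1) x) =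
      toRing ((j + 1) • A + ((j + 1) * j) • B) := by
    have h0 := toRing_add ((j + 1) • A) (((j + 1) * j) • B)
    rw [toRing_nsmul, toRing_nsmul, toRing_castForm, toRing_castForm, toRing_wedge, toRing_wedge,
      toRing_wedge, pow, pow, toRing_wedgePow, toRing_wedgePow] at h0
    refine Eq.trans ?_ h0.symm
    rw [gauduchonForm, toRing_wedge, del_delbar_apply (F.isSmooth_pow _), inChart_pow,
      toRing_flatDel_flatDelbar_wedgePow (chartAt E x).open_target (F.smooth x)
      (mem_chart_target E x), inChart_self, pow, toRing_wedgePow, add_mul, smul_mul_assoc,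
      smul_mul_assoc, mul_assoc, ← pow_add, show j + (n - (j + 1) - 1) = n - 2 by omega]
    congr 1
    -- For `j = 0` the truncated exponents do not add up to `n - 3`, but the coefficient is zero.
    rcases j with _ | j
    · simp
    · congr 1
      rw [mul_assoc _ _ (toRing (flatDelbar _ _)), ((commute_toRing _ _).pow_left _).eq, mul_assoc,
        mul_assoc, ← pow_add, show j + 1 - 1 + (n - (j + 1 + 1) - 1) = n - 3 by omega, mul_assoc]
  have h1 := (toRing_eq_iff (show 2 * (j + 1) + 1 + 1 + 2 * (n - (j + 1) - 1) = 2 * n by omega)).1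
    key v
  have h2 : ((j + 1) • A + ((j + 1) * j) • B) v = (j + 1) • A v + ((j + 1) * j) • B v := rfl
  rw [h1, h2, ha, hb]
  simp only [nsmul_eq_mul]
  push_cast
  ring

/-- On a compact manifold, `∂∂̄(F ^ (n - 1))` is a constant multiple of `F ^ n` only if it
vanishes. -/
theorem eq_zero_of_isFactorAt_sub_one [IsManifold 𝓘(ℂ, E) ω X] [CompactSpace X] [T2Space X]
    [Nonempty X] {hk : n - 1 + 1 ≤ n} {c : ℂ} (h : ∀ x, F.IsFactorAt n (n - 1) hk x c) : c = 0 := by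
  borelize E
  obtain ⟨w, hw⟩ := exists_tuple_wedgePow_pos hdim
  obtain _ | N := n
  · omega
  have hpos : ∀ x₀, ∀ y ∈ (chartAt E x₀).target,
      ∃ s : ℝ, 0 < s ∧ inChart (F.pow (N + 1)) x₀ y w = s := fun x₀ y hy => by
    rw [inChart_pow]
    exact hw _ (F.isPositiveForm_pullback (injective_realDifferential_chart_symm hy))
  -- The constant `-2i` is the inverse of `i/2`. The left side is `∂` of the global form `∂̄(F ^ (n
  -- - 1))`, as Stokes requires.
  have h1 (x : X) : twistForm (1 / 2) (-(Complex.I / 2)) (Gauduchon.delbar (F.pow N)) x =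
      (-2 * Complex.I * c) • F.pow (N + 1) x := by
    rw [← del_eq_twistForm]
    ext v
    have h2 := (toRing_eq_iff (show 2 * N + 1 + 1 + 2 * (N + 1 - N - 1) = 2 * (N + 1) by omega)).1
      (F.toRing_gauduchonForm_sub_one (N + 1) x) v
    have h3 := h x v
    change _ = (-2 * Complex.I * c) * F.pow (N + 1) x v
    rw [mul_assoc, ← h3]
    have h4 (z : ℂ) : z = -2 * Complex.I * (Complex.I / 2 * z) := by
      linear_combination z * Complex.I_mul_I
    exact h2.symm.trans (h4 _)
  have h4 := eq_zero_of_twistForm_eq_smul (finrank_real_eq hdim) w _ _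
    (F.isSmooth_pow N).delbar (F.isSmooth_pow (N + 1)) hpos h1
  simpa using h4

end FiniteDimensional

end HermitianMetric

end Factor

end Gauduchon

end

/-! ### The conclusion, from the quadratic formula and the vanishing at `n - 1`. -/

theorem proposition2p2
    {E : Type*} [NormedAddCommGroup E] [NormedSpace ℂ E]
    (n : ℕ) (hdim : Module.finrank ℂ E = n) (hn : 3 ≤ n)
    -- `X` is a compact complex manifold of dimension `n`
    {X : Type*} [TopologicalSpace X] [ChartedSpace E X] [IsManifold 𝓘(ℂ, E) ω X]
    [T2Space X] [CompactSpace X] [Nonempty X]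
    -- `X` is homogeneous and the Hermitian metric `F` is invariant
    {M : Type*} [TopologicalSpace M] [ChartedSpace E M] [IsManifold 𝓘(ℂ, E) ω M]
    {G : Type*} [Group G] [MulAction G M] (π : M → X)
    (F : Gauduchon.HermitianMetric E X) (hF : F.IsInvariant G π) :
    -- `F` is Gauduchon
    F.IsGauduchon n ∧ F.IsKthGauduchon n (n - 1) ∧
    -- if `F` is `k`-th Gauduchon for one `k`, then it is for all
    (∀ k : ℕ, 1 ≤ k → k ≤ n - 2 → F.IsKthGauduchon n k →
      ∀ l : ℕ, 1 ≤ l → l ≤ n - 2 → F.IsKthGauduchon n l) ∧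
    -- the constants `C k` exist, are unique, and are proportional to `C 1`
    ∃ C : ℕ → ℝ,
      (∀ (k : ℕ) (_ : 1 ≤ k) (hk : k + 1 ≤ n) (c : ℝ),
        F.IsGauduchonConstant n k hk c ↔ c = C k) ∧
      C (n - 1) = 0 ∧
      ∀ k : ℕ, 1 ≤ k → k ≤ n - 2 →
        C k = (k : ℝ) * ((n : ℝ) - k - 1) / ((n : ℝ) - 2) * C 1 := by
  have : FiniteDimensional ℂ E := FiniteDimensional.of_finrank_pos (by omega)
  obtain ⟨x⟩ := ‹Nonempty X›
  obtain ⟨a, b, hab⟩ := Gauduchon.HermitianMetric.exists_isFactorAt_quadratic (F := F) hdim hn x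
  -- `a` and `b` are computed at the single point `x`; homogeneity then gives the same factors at
  -- every point. The subtraction takes place in `ℂ`.
  obtain ⟨f, hf⟩ : ∃ f : ℕ → ℂ, ∀ k, f k = k * a + k * (k - 1) * b := ⟨_, fun _ => rfl⟩
  have hfac (k : ℕ) (h1 : 1 ≤ k) (hk : k + 1 ≤ n) (y : X) : F.IsFactorAt n k hk y (f k) := by
    obtain ⟨j, rfl⟩ := Nat.exists_eq_add_of_le' h1
    refine hF.isFactorAt_congr hdim (x := x) ?_
    rw [hf]
    simpa using hab j hk
  have hre (k : ℕ) (h1 : 1 ≤ k) (hk : k + 1 ≤ n) : f k = ((f k).re : ℂ) :=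
    Complex.ext rfl ((hfac k h1 hk x).im_eq_zero hdim)
  have hlast : f (n - 1) = 0 :=
    Gauduchon.HermitianMetric.eq_zero_of_isFactorAt_sub_one hdim (hfac (n - 1) (by omega) (by omega))
  have hn1 : (n : ℂ) - 1 ≠ 0 := by
    rw [sub_ne_zero]
    exact_mod_cast (by omega : n ≠ 1)
  have hn2 : (n : ℂ) - 2 ≠ 0 := by
    rw [sub_ne_zero]
    exact_mod_cast (by omega : n ≠ 2)
  -- `f (n - 1) = 0` reads `(n - 1) (a + (n - 2) b) = 0`.
  have ha : a = -((n : ℂ) - 2) * b := by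
    rw [hf, Nat.cast_sub (by omega), Nat.cast_one] at hlast
    refine mul_left_cancel₀ hn1 ?_
    linear_combination hlast
  have hf1 (k : ℕ) : f k = k * ((n : ℂ) - k - 1) / ((n : ℂ) - 2) * f 1 := by
    rw [hf, hf, ha]
    field_simp
    push_cast
    ring
  have hkth (k : ℕ) (h1 : 1 ≤ k) (hk : k + 1 ≤ n) : F.IsKthGauduchon n k ↔ f k = 0 :=
    ⟨fun h => (hfac k h1 hk x).unique hdim (Gauduchon.HermitianMetric.isFactorAt_zero hk (h x)),
      fun h y => (h ▸ hfac k h1 hk y).gauduchonForm_eq_zero⟩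
  have hgau : F.IsKthGauduchon n (n - 1) := (hkth (n - 1) (by omega) (by omega)).2 hlast
  refine ⟨(F.isKthGauduchon_sub_one_iff n).1 hgau, hgau, fun k h1 hk h l hl1 hl => ?_,
    fun k => (f k).re, fun k h1 hk c => ⟨fun h => ?_, ?_⟩, ?_, fun k h1 hk => ?_⟩
  · rw [hkth k h1 (by omega), hf1] at h
    -- Here `k ≤ n - 2` is essential: the coefficient vanishes at `k = n - 1`. It follows that `f 1
    -- = 0`, hence `f l = 0`.
    have hk0 : (k : ℂ) * ((n : ℂ) - k - 1) / ((n : ℂ) - 2) ≠ 0 := by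
      refine div_ne_zero (mul_ne_zero (by exact_mod_cast (by omega : k ≠ 0)) ?_) hn2
      rw [sub_sub, sub_ne_zero]
      exact_mod_cast (by omega : n ≠ k + 1)
    rw [hkth l hl1 (by omega), hf1, (mul_eq_zero.1 h).resolve_left hk0, mul_zero]
  · exact Complex.ofReal_injective
      ((Gauduchon.HermitianMetric.IsFactorAt.unique hdim (h x) (hfac k h1 hk x)).trans (hre k h1 hk))
  · rintro rfl y v
    rw [← hre k h1 hk]
    exact hfac k h1 hk y v
  · simp only [hlast, Complex.zero_re]
  · have h2 := hf1 k
    rw [hre k h1 (by omega), hre 1 le_rfl (by omega)] at h2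
    exact_mod_cast h2
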